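/- Let $\Omega,\beta,\eta>0$ be constants and let $\mathbf M$ be the Fourier multiplier on $\mathbb T^3=(\mathbb R/2\pi\mathbb Z)^3$ with symbol $\widehat{\mathbf M}(k)=0$ if $k_3=0$ and, for $k\in\mathbb Z^3$ with $k_3\neq0$, $$\widehat{\mathbf M}(k)=\frac{\bigl(2\Omega k_2k_3|k|^2-\tfrac{\beta^2}{\eta}k_1k_2^2k_3,\;-2\Omega k_1k_3|k|^2-\tfrac{\beta^2}{\eta}k_2^3k_3,\;\tfrac{\beta^2}{\eta}k_2^2(k_1^2+k_2^2)\bigr)}{4\Omega^2k_3^2|k|^2+(\beta^2/\eta)^2k_2^4}.$$ For $\alpha\in[0,1]$ consider, for real-valued mean-free $\theta$ on $\mathbb T^3$, the generalized magnetogeostrophic (MG) equation $$\partial_t\theta+u\cdot\nabla\theta=0,\qquad u=(-\Delta)^{\alpha/2}\mathbf M\theta,\qquad \theta(\cdot,0)=\theta_0 .\qquad (*)$$ Let $H^q$ have the norm $\|\theta\|_{H^q}^2=\sum_{k}(1+|k|^2)^q|\hat\theta(k)|^2$. Fix $r>3$ and, for $s>0$, $\tau>0$, let $G^s_\tau$ be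 the space of real-valued mean-free $\theta$ with $$\|\theta\|_{G^s_\tau}^2=\sum_{k\ne0}|k|^{2r}e^{2\tau|k|^{1/s}}|\hat\theta(k)|^2<\infty .$$ A solution of $(*)$ in $L^\infty(0,T;H^q)$ is understood in the integrated distributional sense: $\theta(t)=\theta_0-\int_0^t(u\cdot\nabla\theta)\,d\sigma$ in the sense of distributions on $\mathbb T^3$ for every $t\in[0,T]$. The equation is called locally Lipschitz $(H^q,G^s_\tau)$ well-posed if there are continuous functions $T,K:[0,\infty)^2\to(0,\infty)$ such that for all $\theta_0^{(1)},\theta_0^{(2)}\in G^s_\tau$, with $T,K$ evaluated at $(\|\theta_0^{(1)}\|_{G^s_\tau},\|\theta_0^{(2)}\|_{G^s_\tau})$, there exist unique real-valued mean-free solutions $\theta^{(1)},\theta^{(2)}\in L^\infty(0,T;H^q)$ with these initial data, and they satisfy $$\|\theta^{(1)}(t)-\theta^{(2)}(t)\|_{H^q}\le K\,\|\theta^{(1)}_0-\theta^{(2)}_0\|_{G^s_\tau}\qquad\text{for all }t\in[0,T];$$ it is called locally Lipschitz $(H^q,G^s_\tau)$ ill-posed if it is not well-posed in this sense. **Theorem.**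 Let $\alpha\in[0,1]$, $q>\alpha+\frac74$ and $s>\frac1{\alpha+1}$. Then the equation $(*)$ is locally Lipschitz $(H^q,G^s_\tau)$ ill-posed for every $\tau>0$. In particular, the non-diffusive MG equation ($\alpha=0$, $u=\mathbf M\theta$) is locally Lipschitz $(H^q,G^s_\tau)$ ill-posed for all $q>\frac74$, $s>1$ and $\tau>0$. -/

import Mathlib

open MeasureTheory Set
open scoped ENNReal NNReal

noncomputable section

namespace ActiveScalar

/-- Frequencies `k = (k₁, k₂, k₃)` are indexed as `k 0, k 1, k 2`. -/
abbrev Freq : Type := Fin 3 → ℤ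

/-- The torus `𝕋³ = (ℝ / 2πℤ)³`, written in the coordinates `y = x / 2π`. In these coordinates
`UnitAddTorus.mFourier k` is the character `x ↦ exp (i k · x)`, the normalised Haar measure is
`(2π)⁻³ dx`, and `UnitAddTorus.mFourierCoeff f k` is the Fourier coefficient
`(2π)⁻³ ∫ f(x) exp (-i k · x) dx`. All differential operators below are taken in the variable `x`,
that is, `∂ⱼ` is the Fourier multiplier with symbol `i kⱼ`. -/
abbrev Torus : Type := UnitAddTorus (Fin 3)

/-- The normalised Haar measure `(2π)⁻³ dx` on the torus (the one of Mathlib's Fourier theory). -/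
abbrev torusMeasure : Measure Torus := Measure.pi fun _ => AddCircle.haarAddCircle

/-- The Hilbert space `L²(𝕋³; ℂ)`. -/
abbrev L2 : Type := Lp ℂ 2 torusMeasure

/-- The Fourier coefficient of `f` at frequency `k`. -/
def coeff (f : Torus → ℂ) (k : Freq) : ℂ := UnitAddTorus.mFourierCoeff f k

/-- `|k|²`. -/
def normSq (k : Freq) : ℝ := ∑ i, (k i : ℝ) ^ 2

/-- `|k|`. -/
def kNorm (k : Freq) : ℝ := Real.sqrt (normSq k)

/-- Real-valued, mean-free functions in `L²(𝕋³)`. -/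
def RealMeanFree (f : L2) : Prop :=
  (∀ᵐ x ∂torusMeasure, (f x).im = 0) ∧ coeff f 0 = 0

open Classical in
/-- The Fourier multiplier operator with symbol `m`: the element of `L²` with Fourier coefficients
`m k * f̂ k`. The value is `0` if `f` is not in the domain of the operator, that is, if these
numbers are not square summable. -/
def multiplier (m : Freq → ℂ) (f : L2) : L2 :=
  if h : Memℓp (fun k => m k * coeff f k) 2 then
    UnitAddTorus.mFourierBasis.repr.symm ⟨fun k => m k * coeff f k, h⟩
  else 0

/-- The `j`-th component of `u = T θ`, for the Fourier multiplier with symbol `T : ℤ³ → ℝ³`. -/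
def velocity (T : Freq → Fin 3 → ℝ) (θ : L2) (j : Fin 3) : L2 :=
  multiplier (fun k => (T k j : ℂ)) θ

/-- The weak partial derivative `∂ⱼ θ`. -/
def partialDeriv (θ : L2) (j : Fin 3) : L2 :=
  multiplier (fun k => Complex.I * (k j : ℂ)) θ

/-- The nonlinearity `u · ∇θ` with `u = T θ`. -/
def advection (T : Freq → Fin 3 → ℝ) (θ : L2) : Torus → ℂ :=
  fun x => ∑ j, velocity T θ j x * partialDeriv θ j x

/-- The Sobolev norm of `H^q`, with value `∞` outside `H^q`. -/
def sobolevNorm (q : ℝ) (f : L2) : ℝ≥0∞ :=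
  (∑' k : Freq, ENNReal.ofReal ((1 + normSq k) ^ q * ‖coeff f k‖ ^ 2)) ^ (1 / 2 : ℝ)

/-- The Gevrey norm of `G^s_τ`, where `r` is the fixed Sobolev exponent in its definition, with
value `∞` outside `G^s_τ`. -/
def gevreyNorm (r s τ : ℝ) (f : L2) : ℝ≥0∞ :=
  (∑' k : {k : Freq // k ≠ 0}, ENNReal.ofReal
    (kNorm k ^ (2 * r) * Real.exp (2 * τ * kNorm k ^ (1 / s)) * ‖coeff f k‖ ^ 2)) ^ (1 / 2 : ℝ)

/-- `θ ∈ L^∞(0, t₁; X)` is a solution on `[0, t₁]` of `∂ₜθ + u · ∇θ = 0`, `u = T θ`, with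
`θ(0) = θ₀`. Here `X` is the space of real mean-free `f` with `normX f < ∞`. The equation is taken
in integrated form `θ(t) = θ₀ - ∫₀ᵗ (u · ∇θ)(s) ds` in the sense of distributions on `𝕋³`, that is,
for every Fourier coefficient. -/
structure IsSolution (T : Freq → Fin 3 → ℝ) (normX : L2 → ℝ≥0∞) (t₁ : ℝ) (θ₀ : L2)
    (θ : ℝ → L2) : Prop where
  realMeanFree : ∀ t ∈ Icc 0 t₁, RealMeanFree (θ t)
  measurable : AEStronglyMeasurable θ (volume.restrict (Icc 0 t₁))
  bounded : essSup (fun t => normX (θ t)) (volume.restrict (Icc 0 t₁)) < ∞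
  integrable : ∀ k : Freq,
    IntervalIntegrable (fun σ => coeff (advection T (θ σ)) k) volume 0 t₁
  equation : ∀ t ∈ Icc 0 t₁, ∀ k : Freq,
    coeff (θ t) k = coeff θ₀ k - ∫ σ in (0 : ℝ)..t, coeff (advection T (θ σ)) k

/-- Local Lipschitz `(X, Y)` well-posedness of `∂ₜθ + u · ∇θ = 0`, `u = T θ`, where `X` and `Y` are
the spaces of real mean-free functions on which `normX`, resp. `normY`, is finite. -/
def LipschitzWellPosed (T : Freq → Fin 3 → ℝ) (normX normY : L2 → ℝ≥0∞) : Prop :=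
  ∃ time lip : ℝ≥0 × ℝ≥0 → ℝ,
    Continuous time ∧ Continuous lip ∧ (∀ p, 0 < time p) ∧ (∀ p, 0 < lip p) ∧
    ∀ φ₁ φ₂ : L2, RealMeanFree φ₁ → normY φ₁ < ∞ → RealMeanFree φ₂ → normY φ₂ < ∞ →
      ∃ θ₁ θ₂ : ℝ → L2,
        IsSolution T normX (time ((normY φ₁).toNNReal, (normY φ₂).toNNReal)) φ₁ θ₁ ∧
        IsSolution T normX (time ((normY φ₁).toNNReal, (normY φ₂).toNNReal)) φ₂ θ₂ ∧
        (∀ θ, IsSolution T normX (time ((normY φ₁).toNNReal, (normY φ₂).toNNReal)) φ₁ θ →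
          EqOn θ θ₁ (Icc 0 (time ((normY φ₁).toNNReal, (normY φ₂).toNNReal)))) ∧
        (∀ θ, IsSolution T normX (time ((normY φ₁).toNNReal, (normY φ₂).toNNReal)) φ₂ θ →
          EqOn θ θ₂ (Icc 0 (time ((normY φ₁).toNNReal, (normY φ₂).toNNReal)))) ∧
        ∀ t ∈ Icc 0 (time ((normY φ₁).toNNReal, (normY φ₂).toNNReal)),
          normX (θ₁ t - θ₂ t) ≤
            ENNReal.ofReal (lip ((normY φ₁).toNNReal, (normY φ₂).toNNReal)) * normY (φ₁ - φ₂)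

/-- Local Lipschitz `(X, Y)` ill-posedness is the failure of well-posedness. -/
def LipschitzIllPosed (T : Freq → Fin 3 → ℝ) (normX normY : L2 → ℝ≥0∞) : Prop :=
  ¬ LipschitzWellPosed T normX normY

/-- The Fourier symbol of the magnetogeostrophic operator `M`. -/
def mgSymbol (Ω β η : ℝ) (k : Freq) : Fin 3 → ℝ :=
  let k₁ : ℝ := k 0
  let k₂ : ℝ := k 1
  let k₃ : ℝ := k 2
  let D : ℝ := 4 * Ω ^ 2 * k₃ ^ 2 * normSq k + (β ^ 2 / η) ^ 2 * k₂ ^ 4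
  if k 2 = 0 then 0 else
    ![(2 * Ω * k₂ * k₃ * normSq k - (β ^ 2 / η) * k₁ * k₂ ^ 2 * k₃) / D,
      (-2 * Ω * k₁ * k₃ * normSq k - (β ^ 2 / η) * k₂ ^ 3 * k₃) / D,
      ((β ^ 2 / η) * k₂ ^ 2 * (k₁ ^ 2 + k₂ ^ 2)) / D]

/-- The Fourier symbol of `(-Δ)^{α/2} M`. -/
def generalizedMGSymbol (Ω β η α : ℝ) (k : Freq) : Fin 3 → ℝ :=
  kNorm k ^ α • mgSymbol Ω β η k

end ActiveScalar

end

/-!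
The shear flow `-2 sin x₃` is stationary, because the symbol of the velocity vanishes at
`±(0, 0, 1)`. Linearising there couples a Fourier coefficient at `(a, b, p)` only with those at
`(a, b, p ± 1)`, through the numbers `T₃(a, b, p) ≥ 0`, which are bounded in `p`. Solutions of such
a cooperative system dominate those of its restriction to `p ∈ {1, 2}`, and along `a = n²`, `b = n`
the couplings between these two sites are of order `n ^ (2 (α + 1))`: the perturbation grows like
`exp (c n ^ (2 (α + 1)) t)`. Its Gevrey norm is only about `exp (τ (3 n²) ^ (1 / s))`, which is of
lower order when `1 / s < α + 1`. Lipschitz dependence on the data makes the quadratic remainder of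
a perturbation of size `ε` of order `ε²`, so it disappears on dividing by `ε → 0`.
-/

noncomputable section

namespace ActiveScalar

open Filter Topology
open scoped ComplexConjugate

section FourierCoefficients

theorem coeff_eq_repr (f : L2) (k : Freq) :
    coeff f k = UnitAddTorus.mFourierBasis.repr f k :=
  (UnitAddTorus.mFourierBasis_repr f k).symm

theorem L2_ext_coeff {f g : L2} (h : ∀ k, coeff f k = coeff g k) : f = g := by
  apply UnitAddTorus.mFourierBasis.repr.injective
  ext k
  rw [← coeff_eq_repr, ← coeff_eq_repr, h]

theorem coeff_add (f g : L2) (k : Freq) : coeff (f + g : L2) k = coeff f k + coeff g k := by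
  simp only [coeff_eq_repr, map_add, lp.coeFn_add, Pi.add_apply]

theorem coeff_sub (f g : L2) (k : Freq) : coeff (f - g : L2) k = coeff f k - coeff g k := by
  simp only [coeff_eq_repr, map_sub, lp.coeFn_sub, Pi.sub_apply]

theorem coeff_smul (c : ℂ) (f : L2) (k : Freq) : coeff (c • f : L2) k = c * coeff f k := by
  simp only [coeff_eq_repr, map_smul, lp.coeFn_smul, Pi.smul_apply, smul_eq_mul]

theorem coeff_congr_ae {f g : Torus → ℂ} (h : f =ᵐ[torusMeasure] g) (k : Freq) :
    coeff f k = coeff g k := by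
  simp only [coeff, UnitAddTorus.mFourierCoeff]
  refine integral_congr_ae ?_
  filter_upwards [h] with x hx
  rw [hx]

theorem norm_mFourier_apply_le_one (k : Freq) (x : Torus) : ‖UnitAddTorus.mFourier k x‖ ≤ 1 :=
  ((UnitAddTorus.mFourier k).norm_coe_le_norm x).trans UnitAddTorus.mFourier_norm.le

theorem coeff_sum {ι : Type*} (s : Finset ι) {F : ι → Torus → ℂ}
    (hF : ∀ i ∈ s, Integrable (F i) torusMeasure) (k : Freq) :
    coeff (fun x => ∑ i ∈ s, F i x) k = ∑ i ∈ s, coeff (F i) k := by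
  simp only [coeff, UnitAddTorus.mFourierCoeff, Finset.smul_sum]
  exact integral_finsetSum s fun i hi => (hF i hi).bdd_mul (c := 1)
    (UnitAddTorus.mFourier (-k)).continuous.aestronglyMeasurable
    (.of_forall (norm_mFourier_apply_le_one (-k)))

theorem enorm_coeff_le (f : Torus → ℂ) (k : Freq) :
    ‖coeff f k‖ₑ ≤ eLpNorm f 1 torusMeasure := by
  rw [eLpNorm_one_eq_lintegral_enorm]
  refine (enorm_integral_le_lintegral_enorm _).trans (lintegral_mono fun x => ?_)
  have h : ‖UnitAddTorus.mFourier (-k) x‖ₑ ≤ 1 := by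
    simpa only [← ofReal_norm, ENNReal.ofReal_le_one] using norm_mFourier_apply_le_one (-k) x
  simpa only [enorm_smul] using mul_le_of_le_one_left' h

end FourierCoefficients

section Products

theorem integrable_mul (f g : L2) : Integrable (fun x => f x * g x) torusMeasure :=
  MemLp.integrable_mul (p := 2) (q := 2) (Lp.memLp f) (Lp.memLp g)

theorem enorm_coeff_mul_le (f g : L2) (k : Freq) :
    ‖coeff (fun x => f x * g x) k‖ₑ ≤ ‖f‖ₑ * ‖g‖ₑ := by
  have holder := eLpNorm_smul_le_mul_eLpNorm (p := 2) (q := 2) (r := 1)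
    (Lp.aestronglyMeasurable g) (Lp.aestronglyMeasurable f)
  rw [Lp.enorm_def, Lp.enorm_def]
  exact (enorm_coeff_le _ k).trans holder

theorem coeff_mul_add (f g h : L2) (k : Freq) :
    coeff (fun x => f x * (g + h : L2) x) k =
      coeff (fun x => f x * g x) k + coeff (fun x => f x * h x) k := by
  have hsum := coeff_sum Finset.univ (F := ![fun x => f x * g x, fun x => f x * h x])
    (by simp [Fin.forall_fin_two, integrable_mul]) k
  simp only [Fin.sum_univ_two, Matrix.cons_val_zero, Matrix.cons_val_one] at hsum
  rw [← hsum]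
  refine coeff_congr_ae ?_ k
  filter_upwards [Lp.coeFn_add g h] with x hx
  rw [hx, Pi.add_apply, mul_add]

theorem coeff_mul_smul (c : ℂ) (f g : L2) (k : Freq) :
    coeff (fun x => f x * (c • g : L2) x) k = c * coeff (fun x => f x * g x) k := by
  rw [coeff, UnitAddTorus.mFourierCoeff, ← smul_eq_mul, coeff, UnitAddTorus.mFourierCoeff,
    ← integral_smul]
  refine integral_congr_ae ?_
  filter_upwards [Lp.coeFn_smul c g] with x hx
  simp only [hx, Pi.smul_apply, smul_eq_mul]
  ring

end Products

section Modes

/-- The character `x ↦ exp (i k · x)` as an element of `L²`. -/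
def expMode (k : Freq) : L2 := UnitAddTorus.mFourierLp 2 k

theorem coeFn_expMode (k : Freq) : expMode k =ᵐ[torusMeasure] UnitAddTorus.mFourier k :=
  UnitAddTorus.coeFn_mFourierLp 2 k

theorem coeff_expMode (k l : Freq) : coeff (expMode k) l = if l = k then 1 else 0 := by
  rw [coeff_eq_repr, expMode, ← UnitAddTorus.coe_mFourierBasis, HilbertBasis.repr_self,
    lp.single_apply, Pi.single_apply]

theorem coeff_mul_expMode (f : L2) (k l : Freq) :
    coeff (fun x => f x * expMode k x) l = coeff f (l - k) := by
  refine integral_congr_ae ?_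
  filter_upwards [coeFn_expMode k] with x hx
  rw [hx, neg_sub, sub_eq_add_neg, UnitAddTorus.mFourier_add, smul_eq_mul, smul_eq_mul]
  ring

/-- The real-valued function `x ↦ 2 Re (z exp (i k · x))`. -/
def realMode (z : ℂ) (k : Freq) : L2 := z • expMode k + conj z • expMode (-k)

theorem coeff_realMode (z : ℂ) (k l : Freq) :
    coeff (realMode z k) l = (if l = k then z else 0) + if l = -k then conj z else 0 := by
  simp only [realMode, coeff_add, coeff_smul, coeff_expMode, mul_ite, mul_one, mul_zero]

theorem realMeanFree_realMode (z : ℂ) {k : Freq} (hk : k ≠ 0) : RealMeanFree (realMode z k) := by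
  refine ⟨?_, by rw [coeff_realMode, if_neg hk.symm, if_neg (neg_ne_zero.2 hk).symm, add_zero]⟩
  filter_upwards [coeFn_expMode k, coeFn_expMode (-k), Lp.coeFn_smul z (expMode k),
    Lp.coeFn_smul (conj z) (expMode (-k)), Lp.coeFn_add (z • expMode k) (conj z • expMode (-k))]
    with x hk hneg hsmul hsmul' hadd
  rw [realMode, hadd, Pi.add_apply, hsmul, hsmul', Pi.smul_apply, Pi.smul_apply, hk, hneg,
    UnitAddTorus.mFourier_neg, smul_eq_mul, smul_eq_mul, ← map_mul, Complex.add_im,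
    Complex.conj_im, add_neg_cancel]

theorem RealMeanFree.add {f g : L2} (hf : RealMeanFree f) (hg : RealMeanFree g) :
    RealMeanFree (f + g) := by
  refine ⟨?_, by rw [coeff_add, hf.2, hg.2, add_zero]⟩
  filter_upwards [hf.1, hg.1, Lp.coeFn_add f g] with x hfx hgx hadd
  rw [hadd, Pi.add_apply, Complex.add_im, hfx, hgx, add_zero]

theorem RealMeanFree.smul {f : L2} (hf : RealMeanFree f) (c : ℝ) :
    RealMeanFree ((c : ℂ) • f) := by
  refine ⟨?_, by rw [coeff_smul, hf.2, mul_zero]⟩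
  filter_upwards [hf.1, Lp.coeFn_smul (c : ℂ) f] with x hfx hsmul
  rw [hsmul, Pi.smul_apply, smul_eq_mul, Complex.im_ofReal_mul, hfx, mul_zero]

end Modes

section Multipliers

theorem eLpNorm_two_count {ι : Type*} [MeasurableSpace ι] [MeasurableSingletonClass ι]
    (a : ι → ℂ) : eLpNorm a 2 .count = (∑' i, ‖a i‖ₑ ^ 2) ^ (1 / 2 : ℝ) := by
  rw [eLpNorm_eq_lintegral_rpow_enorm_toReal two_ne_zero ENNReal.ofNat_ne_top, lintegral_count]
  simp only [ENNReal.toReal_ofNat, ENNReal.rpow_ofNat]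

theorem memℓp_two_iff_eLpNorm_count_lt_top {ι : Type*} [MeasurableSpace ι]
    [MeasurableSingletonClass ι] {a : ι → ℂ} : Memℓp a 2 ↔ eLpNorm a 2 .count < ∞ := by
  rw [memℓp_gen_iff (by norm_num), eLpNorm_two_count,
    ENNReal.rpow_lt_top_iff_of_pos (by norm_num), lt_top_iff_ne_top]
  simp only [ENNReal.toReal_ofNat, Real.rpow_ofNat, ← coe_nnnorm, enorm_eq_nnnorm]
  exact_mod_cast ENNReal.tsum_coe_ne_top_iff_summable.symm

/-- The norm `‖m(D) f‖` in `L²`, with value `∞` outside the domain of the Fourier multiplier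
`m(D)`. -/
def multiplierNorm (m : Freq → ℂ) (f : L2) : ℝ≥0∞ :=
  eLpNorm (fun k => m k * coeff f k) 2 Measure.count

theorem multiplierNorm_eq (m : Freq → ℂ) (f : L2) :
    multiplierNorm m f = (∑' k, ENNReal.ofReal (‖m k‖ ^ 2 * ‖coeff f k‖ ^ 2)) ^ (1 / 2 : ℝ) := by
  simp only [multiplierNorm, eLpNorm_two_count, ← ofReal_norm, norm_mul, ← mul_pow,
    ENNReal.ofReal_pow (mul_nonneg (norm_nonneg _) (norm_nonneg _))]

theorem enorm_eq_eLpNorm_coeff (f : L2) : ‖f‖ₑ = eLpNorm (coeff f) 2 Measure.count := by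
  have hsum := lp.hasSum_norm (p := 2) (by norm_num) (UnitAddTorus.mFourierBasis.repr f)
  simp only [LinearIsometryEquiv.norm_map, ENNReal.toReal_ofNat, Real.rpow_ofNat,
    ← coeff_eq_repr] at hsum
  simp only [eLpNorm_two_count, ← ofReal_norm, ← ENNReal.ofReal_pow (norm_nonneg _)]
  rw [← ENNReal.ofReal_tsum_of_nonneg (fun _ => sq_nonneg _) hsum.summable, hsum.tsum_eq,
    ENNReal.ofReal_rpow_of_nonneg (sq_nonneg _) (by norm_num), ← Real.sqrt_eq_rpow,
    Real.sqrt_sq (norm_nonneg f)]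

variable {m : Freq → ℂ} {f g : L2}

theorem coeff_multiplier (h : multiplierNorm m f < ∞) (k : Freq) :
    coeff (multiplier m f) k = m k * coeff f k := by
  rw [multiplier, dif_pos (memℓp_two_iff_eLpNorm_count_lt_top.2 h), coeff_eq_repr,
    LinearIsometryEquiv.apply_symm_apply]

theorem enorm_multiplier_le (m : Freq → ℂ) (f : L2) :
    ‖multiplier m f‖ₑ ≤ multiplierNorm m f := by
  by_cases h : multiplierNorm m f < ∞
  · rw [enorm_eq_eLpNorm_coeff, funext (coeff_multiplier h), multiplierNorm]
  · rw [not_lt_top_iff.1 h]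
    exact le_top

theorem multiplierNorm_add_le (m : Freq → ℂ) (f g : L2) :
    multiplierNorm m (f + g) ≤ multiplierNorm m f + multiplierNorm m g := by
  simp only [multiplierNorm, coeff_add, mul_add]
  exact eLpNorm_add_le StronglyMeasurable.of_discrete.aestronglyMeasurable
    StronglyMeasurable.of_discrete.aestronglyMeasurable one_le_two

theorem multiplierNorm_smul (m : Freq → ℂ) (c : ℂ) (f : L2) :
    multiplierNorm m (c • f) = ‖c‖ₑ * multiplierNorm m f := by
  simp only [multiplierNorm, coeff_smul, mul_left_comm]
  exact eLpNorm_const_smul c _ _ _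

theorem multiplierNorm_expMode (m : Freq → ℂ) (k : Freq) :
    multiplierNorm m (expMode k) = ‖m k‖ₑ := by
  rw [multiplierNorm_eq, tsum_eq_single k fun l hl => by simp [coeff_expMode, hl], coeff_expMode,
    if_pos rfl, norm_one, one_pow, mul_one, ENNReal.ofReal_pow (norm_nonneg _), ofReal_norm,
    ← ENNReal.rpow_two, ← ENNReal.rpow_mul]
  norm_num

theorem multiplierNorm_le_of_norm_le {w : Freq → ℂ} {A : ℝ} (h : ∀ k, ‖m k‖ ≤ A * ‖w k‖)
    (f : L2) : multiplierNorm m f ≤ ENNReal.ofReal A * multiplierNorm w f := by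
  refine eLpNorm_le_mul_eLpNorm_of_ae_le_mul (.of_forall fun k => ?_) 2
  rw [norm_mul, norm_mul, ← mul_assoc]
  exact mul_le_mul_of_nonneg_right (h k) (norm_nonneg _)

theorem enorm_mul_coeff_le (m : Freq → ℂ) (f : L2) (k : Freq) :
    ‖m k * coeff f k‖ₑ ≤ multiplierNorm m f :=
  enorm_le_eLpNorm_count (fun k => m k * coeff f k) k two_ne_zero

theorem multiplierNorm_realMode_le (m : Freq → ℂ) (z : ℂ) (k : Freq) :
    multiplierNorm m (realMode z k) ≤ ‖z‖ₑ * (‖m k‖ₑ + ‖m (-k)‖ₑ) := by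
  have hconj : ‖conj z‖ₑ = ‖z‖ₑ := by simp only [← ofReal_norm, RCLike.norm_conj]
  rw [mul_add]
  refine (multiplierNorm_add_le _ _ _).trans_eq ?_
  rw [multiplierNorm_smul, multiplierNorm_smul, multiplierNorm_expMode, multiplierNorm_expMode,
    hconj]

theorem multiplierNorm_realMode_lt_top (m : Freq → ℂ) (z : ℂ) (k : Freq) :
    multiplierNorm m (realMode z k) < ∞ :=
  (multiplierNorm_realMode_le m z k).trans_lt <|
    ENNReal.mul_lt_top enorm_lt_top (ENNReal.add_lt_top.2 ⟨enorm_lt_top, enorm_lt_top⟩)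

theorem multiplier_add (hf : multiplierNorm m f < ∞) (hg : multiplierNorm m g < ∞) :
    multiplier m (f + g) = multiplier m f + multiplier m g := by
  have hfg := (multiplierNorm_add_le m f g).trans_lt (ENNReal.add_lt_top.2 ⟨hf, hg⟩)
  refine L2_ext_coeff fun k => ?_
  rw [coeff_add, coeff_multiplier hf, coeff_multiplier hg, coeff_multiplier hfg, coeff_add,
    mul_add]

theorem multiplier_realMode (m : Freq → ℂ) (z : ℂ) (k : Freq) :
    multiplier m (realMode z k) = (m k * z) • expMode k + (m (-k) * conj z) • expMode (-k) := by
  refine L2_ext_coeff fun l => ?_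
  rw [coeff_multiplier (multiplierNorm_realMode_lt_top m z k), coeff_realMode, coeff_add,
    coeff_smul, coeff_smul, coeff_expMode, coeff_expMode]
  split_ifs <;> simp_all [mul_add]

end Multipliers

section Frequencies

theorem normSq_nonneg (k : Freq) : 0 ≤ normSq k := Finset.sum_nonneg fun _ _ => sq_nonneg _

theorem kNorm_nonneg (k : Freq) : 0 ≤ kNorm k := Real.sqrt_nonneg _

theorem sq_kNorm (k : Freq) : kNorm k ^ 2 = normSq k := Real.sq_sqrt (normSq_nonneg k)

theorem kNorm_neg (k : Freq) : kNorm (-k) = kNorm k := by simp [kNorm, normSq]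

theorem normSq_eq (k : Freq) : normSq k = (k 0 : ℝ) ^ 2 + (k 1 : ℝ) ^ 2 + (k 2 : ℝ) ^ 2 :=
  Fin.sum_univ_three _

theorem abs_apply_le_kNorm (k : Freq) (j : Fin 3) : |(k j : ℝ)| ≤ kNorm k :=
  Real.abs_le_sqrt <| Finset.single_le_sum (f := fun i => (k i : ℝ) ^ 2)
    (fun _ _ => sq_nonneg _) (Finset.mem_univ j)

theorem one_le_kNorm {k : Freq} (hk : k ≠ 0) : 1 ≤ kNorm k := by
  obtain ⟨j, hj⟩ := Function.ne_iff.1 hk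
  have : (1 : ℝ) ≤ |(k j : ℝ)| := by exact_mod_cast Int.one_le_abs hj
  exact this.trans (abs_apply_le_kNorm k j)

end Frequencies

section Weights

/-- The weight `(1 + |k|²)^(q/2)` of the Sobolev norm of `H^q`. -/
def sobolevWeight (q : ℝ) (k : Freq) : ℂ := ((1 + normSq k) ^ (q / 2) : ℝ)

theorem norm_sobolevWeight (q : ℝ) (k : Freq) : ‖sobolevWeight q k‖ = (1 + normSq k) ^ (q / 2) :=
  Complex.norm_of_nonneg (Real.rpow_nonneg (by linarith [normSq_nonneg k]) _)

theorem sobolevNorm_eq_multiplierNorm (q : ℝ) :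
    sobolevNorm q = multiplierNorm (sobolevWeight q) := by
  ext f
  have hsq (k : Freq) : ((1 + normSq k) ^ (q / 2)) ^ 2 = (1 + normSq k) ^ q := by
    rw [← Real.rpow_mul_natCast (by linarith [normSq_nonneg k]), Nat.cast_ofNat,
      div_mul_cancel₀ q two_ne_zero]
  simp only [sobolevNorm, multiplierNorm_eq, norm_sobolevWeight, hsq]

theorem kNorm_rpow_le_norm_sobolevWeight {p q : ℝ} (hp : 0 ≤ p) (hpq : p ≤ q) (k : Freq) :
    kNorm k ^ p ≤ ‖sobolevWeight q k‖ := by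
  have hk := normSq_nonneg k
  calc kNorm k ^ p ≤ √(1 + normSq k) ^ p :=
        Real.rpow_le_rpow (kNorm_nonneg k) (Real.sqrt_le_sqrt (by linarith)) hp
    _ ≤ √(1 + normSq k) ^ q :=
        Real.rpow_le_rpow_of_exponent_le (Real.one_le_sqrt.2 (by linarith)) hpq
    _ = ‖sobolevWeight q k‖ := by
        rw [norm_sobolevWeight, Real.rpow_div_two_eq_sqrt q (by linarith)]

open Classical in
/-- The weight `|k|^r exp (τ |k|^(1/s))` of the Gevrey norm of `G^s_τ`, set to `0` at `k = 0`. -/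
def gevreyWeight (r s τ : ℝ) (k : Freq) : ℂ :=
  if k = 0 then 0 else (kNorm k ^ r * Real.exp (τ * kNorm k ^ (1 / s)) : ℝ)

theorem norm_gevreyWeight {k : Freq} (hk : k ≠ 0) (r s τ : ℝ) :
    ‖gevreyWeight r s τ k‖ = kNorm k ^ r * Real.exp (τ * kNorm k ^ (1 / s)) := by
  have := kNorm_nonneg k
  rw [gevreyWeight, if_neg hk, Complex.norm_of_nonneg (by positivity)]

theorem gevreyNorm_eq_multiplierNorm (r s τ : ℝ) :
    gevreyNorm r s τ = multiplierNorm (gevreyWeight r s τ) := by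
  ext f
  have hsq {k : Freq} (hk : k ≠ 0) : ‖gevreyWeight r s τ k‖ ^ 2 =
      kNorm k ^ (2 * r) * Real.exp (2 * τ * kNorm k ^ (1 / s)) := by
    rw [norm_gevreyWeight hk, mul_pow, ← Real.rpow_mul_natCast (kNorm_nonneg k), ← Real.exp_nat_mul]
    ring_nf
  have hsupport : Function.support (fun k => ENNReal.ofReal
      (‖gevreyWeight r s τ k‖ ^ 2 * ‖coeff f k‖ ^ 2)) ⊆ {k | k ≠ 0} := by
    rintro k hk rfl
    simp [gevreyWeight] at hk
  rw [gevreyNorm, multiplierNorm_eq, ← tsum_subtype_eq_of_support_subset hsupport]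
  congr 1
  exact tsum_congr fun k => by rw [hsq k.2]

end Weights

section ShearFlow

variable {T : Freq → Fin 3 → ℝ}

theorem coeff_advection (T : Freq → Fin 3 → ℝ) (θ : L2) (k : Freq) :
    coeff (advection T θ) k =
      ∑ j, coeff (fun x => velocity T θ j x * partialDeriv θ j x) k :=
  coeff_sum Finset.univ (fun _ _ => integrable_mul _ _) k

theorem enorm_coeff_advection_le_sum (T : Freq → Fin 3 → ℝ) (θ : L2) (k : Freq) :
    ‖coeff (advection T θ) k‖ₑ ≤ ∑ j, ‖velocity T θ j‖ₑ * ‖partialDeriv θ j‖ₑ := by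
  rw [coeff_advection]
  exact (enorm_sum_le _ _).trans (Finset.sum_le_sum fun j _ => enorm_coeff_mul_le _ _ k)

theorem coeff_mul_partialDeriv_realMode (f : L2) (z : ℂ) (l : Freq) (j : Fin 3) (k : Freq) :
    coeff (fun x => f x * partialDeriv (realMode z l) j x) k =
      Complex.I * l j * (z * coeff f (k - l) - conj z * coeff f (k + l)) := by
  rw [partialDeriv, multiplier_realMode, coeff_mul_add, coeff_mul_smul, coeff_mul_smul,
    coeff_mul_expMode, coeff_mul_expMode, sub_neg_eq_add, Pi.neg_apply, Int.cast_neg]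
  ring

theorem velocity_realMode {l : Freq} (hT : T l = 0) (hT' : T (-l) = 0) (z : ℂ) (j : Fin 3) :
    velocity T (realMode z l) j = 0 := by
  simp [velocity, multiplier_realMode, hT, hT']

theorem coeff_advection_realMode {l : Freq} (hT : T l = 0) (hT' : T (-l) = 0) (z : ℂ) (k : Freq) :
    coeff (advection T (realMode z l)) k = 0 := by
  simpa [velocity_realMode hT hT'] using enorm_coeff_advection_le_sum T (realMode z l) k

theorem coeff_advection_realMode_add {l : Freq} (hT : T l = 0) (hT' : T (-l) = 0) (z : ℂ) {f : L2}
    (hvel : ∀ j, multiplierNorm (fun k => (T k j : ℂ)) f < ∞)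
    (hderiv : ∀ j, multiplierNorm (fun k => Complex.I * (k j : ℂ)) f < ∞) (k : Freq) :
    coeff (advection T (realMode z l + f)) k = coeff (advection T f) k +
      ∑ j, Complex.I * l j * (z * (T (k - l) j * coeff f (k - l)) -
        conj z * (T (k + l) j * coeff f (k + l))) := by
  rw [coeff_advection, coeff_advection, ← Finset.sum_add_distrib]
  refine Finset.sum_congr rfl fun j _ => ?_
  have hvel_add : velocity T (realMode z l + f) j = velocity T f j := by
    rw [velocity, multiplier_add (multiplierNorm_realMode_lt_top _ _ _) (hvel j), ← velocity,
      velocity_realMode hT hT', zero_add, velocity]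
  have hderiv_add :
      partialDeriv (realMode z l + f) j = partialDeriv (realMode z l) j + partialDeriv f j :=
    multiplier_add (multiplierNorm_realMode_lt_top _ _ _) (hderiv j)
  rw [hvel_add, hderiv_add, coeff_mul_add, coeff_mul_partialDeriv_realMode, add_comm, velocity,
    coeff_multiplier (hvel j), coeff_multiplier (hvel j)]

theorem multiplierNorm_velocity_symbol_le {w : Freq → ℂ} {A : ℝ}
    (hT : ∀ k j, |T k j| ≤ A * ‖w k‖) (f : L2) (j : Fin 3) :
    multiplierNorm (fun k => (T k j : ℂ)) f ≤ ENNReal.ofReal A * multiplierNorm w f :=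
  multiplierNorm_le_of_norm_le (fun k => (Complex.norm_real _).trans_le (hT k j)) f

theorem multiplierNorm_derivative_symbol_le {w : Freq → ℂ} (hw : ∀ k, kNorm k ≤ ‖w k‖) (f : L2)
    (j : Fin 3) : multiplierNorm (fun k => Complex.I * (k j : ℂ)) f ≤ multiplierNorm w f := by
  have hbound (k : Freq) : ‖Complex.I * (k j : ℂ)‖ ≤ 1 * ‖w k‖ := by
    rw [norm_mul, Complex.norm_I, one_mul, one_mul, Complex.norm_intCast]
    exact (abs_apply_le_kNorm k j).trans (hw k)
  simpa using multiplierNorm_le_of_norm_le hbound f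

theorem norm_coeff_advection_le {w : Freq → ℂ} {A δ : ℝ}
    (hw : ∀ k, kNorm k ≤ ‖w k‖) (hT : ∀ k j, |T k j| ≤ A * ‖w k‖) (hA : 0 ≤ A) (hδ : 0 ≤ δ)
    {f : L2} (hf : multiplierNorm w f ≤ ENNReal.ofReal δ) (k : Freq) :
    ‖coeff (advection T f) k‖ ≤ 3 * A * δ ^ 2 := by
  have hvelocity (j : Fin 3) : ‖velocity T f j‖ₑ ≤ ENNReal.ofReal A * ENNReal.ofReal δ :=
    (enorm_multiplier_le _ f).trans <| (multiplierNorm_velocity_symbol_le hT f j).trans <|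
      mul_le_mul_right hf _
  have hgradient (j : Fin 3) : ‖partialDeriv f j‖ₑ ≤ ENNReal.ofReal δ :=
    (enorm_multiplier_le _ f).trans <| (multiplierNorm_derivative_symbol_le hw f j).trans hf
  rw [← ENNReal.ofReal_le_ofReal_iff (by positivity), ofReal_norm]
  calc ‖coeff (advection T f) k‖ₑ
      ≤ ∑ j, ‖velocity T f j‖ₑ * ‖partialDeriv f j‖ₑ := enorm_coeff_advection_le_sum T f k
    _ ≤ ∑ _j : Fin 3, ENNReal.ofReal A * ENNReal.ofReal δ * ENNReal.ofReal δ :=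
        Finset.sum_le_sum fun j _ => mul_le_mul' (hvelocity j) (hgradient j)
    _ = ENNReal.ofReal (3 * A * δ ^ 2) := by
        rw [Finset.sum_const, Finset.card_univ, Fintype.card_fin, nsmul_eq_mul,
          ENNReal.ofReal_mul (by positivity), ENNReal.ofReal_mul (by positivity),
          ENNReal.ofReal_pow hδ, ENNReal.ofReal_ofNat]
        push_cast
        ring

end ShearFlow

section CooperativeSystems

theorem integral_mul_exp_mul (c t : ℝ) :
    ∫ s in (0 : ℝ)..t, c * Real.exp (c * s) = Real.exp (c * t) - 1 := by
  have hderiv (s : ℝ) : HasDerivAt (fun s => Real.exp (c * s)) (c * Real.exp (c * s)) s := by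
    simpa [mul_comm] using ((hasDerivAt_id s).const_mul c).exp
  rw [intervalIntegral.integral_eq_sub_of_hasDerivAt (fun s _ => hderiv s)
    (Continuous.intervalIntegrable (by fun_prop) _ _), mul_zero, Real.exp_zero]

variable {ι : Type*} {N : ι → Finset ι} {c : ι → ι → ℝ} {Λ η t₁ : ℝ}

theorem intervalIntegrable_coupling {x : ι → ℝ → ℝ} (hx : ∀ i, ContinuousOn (x i) (Icc 0 t₁))
    (i : ι) {t : ℝ} (ht : t ∈ Icc 0 t₁) :
    IntervalIntegrable (fun s => ∑ j ∈ N i, c i j * x j s - η) volume 0 t := by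
  have hcont : ContinuousOn (fun s => ∑ j ∈ N i, c i j * x j s - η) (Icc 0 t₁) := by fun_prop
  exact (hcont.mono (Icc_subset_Icc_right ht.2)).intervalIntegrable_of_Icc ht.1

theorem cooperative_bootstrap (hc : ∀ i j, 0 ≤ c i j) (hΛ : ∀ i, ∑ j ∈ N i, c i j ≤ Λ)
    (hη : 0 ≤ η) {e : ι → ℝ → ℝ} (he : ∀ i, ContinuousOn (e i) (Icc 0 t₁))
    (hsuper : ∀ i, ∀ t ∈ Icc 0 t₁, ∫ s in (0 : ℝ)..t, (∑ j ∈ N i, c i j * e j s - η) ≤ e i t)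
    {X : ℝ} (hX : 0 ≤ X) (hlower : ∀ i, ∀ t ∈ Icc 0 t₁, -(X * Real.exp (2 * Λ * t)) ≤ e i t)
    (i : ι) {t : ℝ} (ht : t ∈ Icc 0 t₁) :
    -((X / 2 + η * t₁) * Real.exp (2 * Λ * t)) ≤ e i t := by
  have hΛ₀ : 0 ≤ Λ := (Finset.sum_nonneg fun j _ => hc i j).trans (hΛ i)
  have hcoupling : ∀ s ∈ Icc 0 t,
      -(X / 2) * (2 * Λ * Real.exp (2 * Λ * s)) - η ≤ ∑ j ∈ N i, c i j * e j s - η := by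
    intro s hs
    have hXs : 0 ≤ X * Real.exp (2 * Λ * s) := by positivity
    have hsum : ∑ j ∈ N i, c i j * -(X * Real.exp (2 * Λ * s)) ≤ ∑ j ∈ N i, c i j * e j s :=
      Finset.sum_le_sum fun j _ =>
        mul_le_mul_of_nonneg_left (hlower j s ⟨hs.1, hs.2.trans ht.2⟩) (hc i j)
    rw [← Finset.sum_mul] at hsum
    linarith [mul_le_mul_of_nonneg_right (hΛ i) hXs]
  have hintegral := intervalIntegral.integral_mono_on ht.1
    (Continuous.intervalIntegrable (by fun_prop) _ _) (intervalIntegrable_coupling he i ht)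
    hcoupling
  rw [intervalIntegral.integral_sub (Continuous.intervalIntegrable (by fun_prop) _ _)
    (Continuous.intervalIntegrable (by fun_prop) _ _), intervalIntegral.integral_const_mul,
    integral_mul_exp_mul, intervalIntegral.integral_const, smul_eq_mul, sub_zero] at hintegral
  have hexp : 1 ≤ Real.exp (2 * Λ * t) :=
    Real.one_le_exp (mul_nonneg (by positivity) ht.1)
  have hηt : t * η ≤ η * t₁ * Real.exp (2 * Λ * t) := by
    have ht₁ := ht.1.trans ht.2
    rw [mul_comm t]
    exact (mul_le_mul_of_nonneg_left ht.2 hη).trans (le_mul_of_one_le_right (by positivity) hexp)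
  linarith [hsuper i t ht]

/-- In the weighted norm `sup |e i t| exp (-2 Λ t)` the coupling is a contraction by `1/2`. -/
theorem cooperative_lower_bound (hc : ∀ i j, 0 ≤ c i j) (hΛ : ∀ i, ∑ j ∈ N i, c i j ≤ Λ)
    (hη : 0 ≤ η) {e : ι → ℝ → ℝ} (he : ∀ i, ContinuousOn (e i) (Icc 0 t₁))
    (hsuper : ∀ i, ∀ t ∈ Icc 0 t₁, ∫ s in (0 : ℝ)..t, (∑ j ∈ N i, c i j * e j s - η) ≤ e i t)
    {B : ℝ} (hB : 0 ≤ B) (hlower : ∀ i, ∀ t ∈ Icc 0 t₁, -B ≤ e i t)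
    (i : ι) {t : ℝ} (ht : t ∈ Icc 0 t₁) :
    -(2 * η * t₁ * Real.exp (2 * Λ * t)) ≤ e i t := by
  set S : Set ℝ := {X | 0 ≤ X ∧ ∀ i, ∀ t ∈ Icc 0 t₁, -(X * Real.exp (2 * Λ * t)) ≤ e i t}
  have hS_bdd : BddBelow S := ⟨0, fun X hX => hX.1⟩
  have hS_nonempty : S.Nonempty := by
    refine ⟨B, hB, fun i t ht => le_trans (neg_le_neg ?_) (hlower i t ht)⟩
    have hΛ₀ : 0 ≤ Λ := (Finset.sum_nonneg fun j _ => hc i j).trans (hΛ i)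
    exact le_mul_of_one_le_right hB (Real.one_le_exp (mul_nonneg (by positivity) ht.1))
  have hS_step : ∀ X ∈ S, X / 2 + η * t₁ ∈ S := fun X hX =>
    ⟨add_nonneg (div_nonneg hX.1 zero_le_two) (mul_nonneg hη (ht.1.trans ht.2)), fun i t ht =>
      cooperative_bootstrap hc hΛ hη he hsuper hX.1 hX.2 i ht⟩
  have hinf : sInf S ≤ 2 * η * t₁ := by
    have hle : 2 * (sInf S - η * t₁) ≤ sInf S :=
      le_csInf hS_nonempty fun X hX => by linarith [csInf_le hS_bdd (hS_step X hX)]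
    linarith
  have hbound : -e i t / Real.exp (2 * Λ * t) ≤ sInf S := le_csInf hS_nonempty fun X hX => by
    rw [div_le_iff₀ (Real.exp_pos _)]
    linarith [hX.2 i t ht]
  linarith [(div_le_iff₀ (Real.exp_pos _)).1 (hbound.trans hinf)]

theorem supersolution_sub_exp {μ : ℝ} {b : ι → ℝ} (hb : ∀ i, μ * b i ≤ ∑ j ∈ N i, c i j * b j)
    {x : ι → ℝ → ℝ} (hx : ∀ i, ContinuousOn (x i) (Icc 0 t₁))
    (hsuper : ∀ i, ∀ t ∈ Icc 0 t₁,
      b i + ∫ s in (0 : ℝ)..t, (∑ j ∈ N i, c i j * x j s - η) ≤ x i t)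
    (i : ι) {t : ℝ} (ht : t ∈ Icc 0 t₁) :
    ∫ s in (0 : ℝ)..t, (∑ j ∈ N i, c i j * (x j s - b j * Real.exp (μ * s)) - η) ≤
      x i t - b i * Real.exp (μ * t) := by
  have hint := intervalIntegrable_coupling (N := N) (c := c) (η := η) hx i ht
  have hexp : IntervalIntegrable (fun s => b i * (μ * Real.exp (μ * s))) volume 0 t :=
    Continuous.intervalIntegrable (by fun_prop) _ _
  have hsplit : ∫ s in (0 : ℝ)..t, (∑ j ∈ N i, c i j * (x j s - b j * Real.exp (μ * s)) - η) ≤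
      ∫ s in (0 : ℝ)..t, ((∑ j ∈ N i, c i j * x j s - η) - b i * (μ * Real.exp (μ * s))) := by
    refine intervalIntegral.integral_mono_on ht.1
      (intervalIntegrable_coupling (fun j => (hx j).sub (by fun_prop)) i ht) (hint.sub hexp)
      fun s _ => ?_
    simp only [mul_sub, Finset.sum_sub_distrib, ← mul_assoc, ← Finset.sum_mul]
    linarith [mul_le_mul_of_nonneg_right (hb i) (Real.exp_pos (μ * s)).le]
  rw [intervalIntegral.integral_sub hint hexp, intervalIntegral.integral_const_mul,
    integral_mul_exp_mul] at hsplit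
  linarith [hsuper i t ht]

theorem cooperative_growth (hc : ∀ i j, 0 ≤ c i j) (hΛ : ∀ i, ∑ j ∈ N i, c i j ≤ Λ)
    (hη : 0 ≤ η) {μ : ℝ} {b : ι → ℝ} (hb : ∀ i, μ * b i ≤ ∑ j ∈ N i, c i j * b j)
    {x : ι → ℝ → ℝ} (hx : ∀ i, ContinuousOn (x i) (Icc 0 t₁))
    (hsuper : ∀ i, ∀ t ∈ Icc 0 t₁,
      b i + ∫ s in (0 : ℝ)..t, (∑ j ∈ N i, c i j * x j s - η) ≤ x i t)
    {B : ℝ} (hB : ∀ i, ∀ t ∈ Icc 0 t₁, |x i t| ≤ B) (i : ι) {t : ℝ} (ht : t ∈ Icc 0 t₁) :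
    b i * Real.exp (μ * t) - 2 * η * t₁ * Real.exp (2 * Λ * t) ≤ x i t := by
  have ht₁ : 0 ≤ t₁ := ht.1.trans ht.2
  have hB₀ : 0 ≤ B := (abs_nonneg _).trans (hB i t ht)
  have hbB (i : ι) : b i ≤ B := by
    have hinit := hsuper i 0 (left_mem_Icc.2 ht₁)
    rw [intervalIntegral.integral_same, add_zero] at hinit
    exact hinit.trans (le_of_abs_le (hB i 0 (left_mem_Icc.2 ht₁)))
  have hlower : ∀ i, ∀ t ∈ Icc 0 t₁,
      -(B + B * Real.exp (|μ| * t₁)) ≤ x i t - b i * Real.exp (μ * t) := by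
    intro i t ht
    have hexp : Real.exp (μ * t) ≤ Real.exp (|μ| * t₁) :=
      Real.exp_le_exp.2 (mul_le_mul (le_abs_self μ) ht.2 ht.1 (abs_nonneg μ))
    linarith [neg_le_of_abs_le (hB i t ht), mul_le_mul (hbB i) hexp (Real.exp_pos _).le hB₀]
  have hcont (i : ι) : ContinuousOn (fun s => x i s - b i * Real.exp (μ * s)) (Icc 0 t₁) :=
    (hx i).sub (by fun_prop)
  have hbound := cooperative_lower_bound hc hΛ hη hcont
    (fun i t ht => supersolution_sub_exp hb hx hsuper i ht) (by positivity) hlower i ht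
  linarith

end CooperativeSystems

section Stability

variable {T : Freq → Fin 3 → ℝ} {normX : L2 → ℝ≥0∞} {t₁ : ℝ} {φ : L2} {θ : ℝ → L2}

theorem IsSolution.mono {t₂ : ℝ} (h : IsSolution T normX t₁ φ θ) (ht₂ : 0 ≤ t₂) (ht : t₂ ≤ t₁) :
    IsSolution T normX t₂ φ θ where
  realMeanFree t hmem := h.realMeanFree t (Icc_subset_Icc_right ht hmem)
  measurable := h.measurable.mono_measure (Measure.restrict_mono_set _ (Icc_subset_Icc_right ht))
  bounded := (essSup_mono_measure' (Measure.restrict_mono_set _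
    (Icc_subset_Icc_right ht))).trans_lt h.bounded
  integrable k := (h.integrable k).mono_set <| by
    rw [uIcc_of_le ht₂, uIcc_of_le (ht₂.trans ht)]
    exact Icc_subset_Icc_right ht
  equation t hmem := h.equation t (Icc_subset_Icc_right ht hmem)

theorem IsSolution.continuousOn_coeff (h : IsSolution T normX t₁ φ θ) (k : Freq) :
    ContinuousOn (fun t => coeff (θ t) k) (Icc 0 t₁) := by
  have hprimitive := intervalIntegral.continuousOn_primitive_interval' (h.integrable k)
    left_mem_uIcc
  exact (continuousOn_const.sub (hprimitive.mono Icc_subset_uIcc)).congr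
    fun t ht => h.equation t ht k

theorem isSolution_const (hφ : RealMeanFree φ) (hX : normX φ < ∞)
    (hstationary : ∀ k, coeff (advection T φ) k = 0) (t₁ : ℝ) :
    IsSolution T normX t₁ φ fun _ => φ where
  realMeanFree _ _ := hφ
  measurable := aestronglyMeasurable_const
  bounded := (essSup_le_of_ae_le _ (.of_forall fun _ => le_rfl)).trans_lt hX
  integrable k := by simp [hstationary]
  equation t _ k := by simp [hstationary]

theorem tendsto_multiplierNorm_add_smul {v : Freq → ℂ} {f : L2} (hφ : multiplierNorm v φ < ∞)
    (hf : multiplierNorm v f < ∞) :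
    Tendsto (fun ε : ℝ => multiplierNorm v (φ + (ε : ℂ) • f)) (𝓝 0) (𝓝 (multiplierNorm v φ)) := by
  have hsmall : Tendsto (fun ε : ℝ => multiplierNorm v ((ε : ℂ) • f)) (𝓝 0) (𝓝 0) := by
    have henorm : Tendsto (fun ε : ℝ => ‖(ε : ℂ)‖ₑ) (𝓝 0) (𝓝 0) := by
      have : Continuous fun ε : ℝ => ‖(ε : ℂ)‖ₑ := by fun_prop
      simpa using this.tendsto 0
    simpa only [multiplierNorm_smul, zero_mul] using
      ENNReal.Tendsto.mul_const henorm (Or.inr hf.ne)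
  have hlower := ENNReal.Tendsto.sub tendsto_const_nhds hsmall (Or.inl hφ.ne)
  have hupper := hsmall.const_add (multiplierNorm v φ)
  rw [tsub_zero] at hlower
  rw [add_zero] at hupper
  refine tendsto_of_tendsto_of_tendsto_of_le_of_le hlower hupper (fun ε => ?_)
    fun ε => multiplierNorm_add_le _ _ _
  have hneg : multiplierNorm v (-(ε : ℂ) • f) = multiplierNorm v ((ε : ℂ) • f) := by
    rw [multiplierNorm_smul, multiplierNorm_smul, enorm_neg]
  refine tsub_le_iff_right.2 ?_
  calc multiplierNorm v φ = multiplierNorm v (φ + (ε : ℂ) • f + -(ε : ℂ) • f) := by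
        rw [neg_smul, add_neg_cancel_right]
    _ ≤ _ := (multiplierNorm_add_le _ _ _).trans_eq (by rw [hneg])

/-- Continuity of the existence time and of the Lipschitz constant makes them uniform along
`φ + ε • f` as `ε → 0`. -/
theorem LipschitzWellPosed.exists_solution_near_stationary {v : Freq → ℂ}
    (hwp : LipschitzWellPosed T normX (multiplierNorm v)) (hφ : RealMeanFree φ)
    (hX : normX φ < ∞) (hY : multiplierNorm v φ < ∞)
    (hstationary : ∀ k, coeff (advection T φ) k = 0) :
    ∃ t₁ > 0, ∃ K > 0, ∀ f, RealMeanFree f → multiplierNorm v f < ∞ → ∀ᶠ ε : ℝ in 𝓝[>] 0,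
      ∃ θ, IsSolution T normX t₁ (φ + (ε : ℂ) • f) θ ∧
        ∀ t ∈ Icc 0 t₁, normX (θ t - φ) ≤ ENNReal.ofReal (K * ε) * multiplierNorm v f := by
  obtain ⟨time, lip, htime, hlip, htime_pos, hlip_pos, hsolve⟩ := hwp
  set p₀ := ((multiplierNorm v φ).toNNReal, (multiplierNorm v φ).toNNReal)
  refine ⟨time p₀ / 2, half_pos (htime_pos p₀), lip p₀ + 1, by linarith [hlip_pos p₀],
    fun f hf hfY => ?_⟩
  have hnorm := (tendsto_multiplierNorm_add_smul hY hfY).mono_left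
    (nhdsWithin_le_nhds (s := Ioi 0))
  have hpair : Tendsto (fun ε : ℝ => ((multiplierNorm v (φ + (ε : ℂ) • f)).toNNReal,
      (multiplierNorm v φ).toNNReal)) (𝓝[>] 0) (𝓝 p₀) :=
    ((ENNReal.tendsto_toNNReal hY.ne).comp hnorm).prodMk_nhds tendsto_const_nhds
  filter_upwards [self_mem_nhdsWithin, hnorm.eventually_lt_const hY,
    (htime.tendsto p₀).comp hpair |>.eventually_const_lt (half_lt_self (htime_pos p₀)),
    (hlip.tendsto p₀).comp hpair |>.eventually_lt_const (lt_add_one (lip p₀))]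
    with ε (hε : 0 < ε) hfinite htime_lt hlip_lt
  obtain ⟨θ, θ', hθ, -, -, hunique, hbound⟩ :=
    hsolve _ φ (hφ.add (hf.smul ε)) hfinite hφ hY
  refine ⟨θ, hθ.mono (half_pos (htime_pos p₀)).le htime_lt.le, fun t ht => ?_⟩
  have hmem := Icc_subset_Icc_right htime_lt.le ht
  have hstable := hbound t hmem
  rw [← hunique _ (isSolution_const hφ hX hstationary _) hmem, add_sub_cancel_left,
    multiplierNorm_smul, ← mul_assoc] at hstable
  refine hstable.trans (mul_le_mul_left ?_ _)
  rw [ENNReal.ofReal_mul (by linarith [hlip_pos p₀]), ← ofReal_norm, Complex.norm_of_nonneg hε.le]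
  exact mul_le_mul_left (ENNReal.ofReal_le_ofReal hlip_lt.le) _

end Stability

section Chains

/-- The frequency `(0, 0, 1)` of the stationary shear flow. -/
def axis : Freq := ![0, 0, 1]

/-- The frequency `(a, b, p)`. For fixed `a` and `b` these form the chains along which the
linearisation at `steady` couples neighbouring Fourier coefficients. -/
def mode (a b p : ℤ) : Freq := ![a, b, p]

/-- The function `-2 sin x₃`, a stationary solution when the symbol `T` vanishes at `±axis`. -/
def steady : L2 := realMode Complex.I axis

/-- The function `2 cos (a x₁ + b x₂ + x₃) + 2 cos (a x₁ + b x₂ + 2 x₃)`, an unstable perturbation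
of `steady`. -/
def perturbation (a b : ℤ) : L2 := realMode 1 (mode a b 1) + realMode 1 (mode a b 2)

variable {a b : ℤ}

theorem mode_sub_axis (a b p : ℤ) : mode a b p - axis = mode a b (p - 1) := by
  ext j; fin_cases j <;> simp [mode, axis]

theorem mode_add_axis (a b p : ℤ) : mode a b p + axis = mode a b (p + 1) := by
  ext j; fin_cases j <;> simp [mode, axis]

theorem mode_injective (a b : ℤ) : Function.Injective (mode a b) := fun _ _ h => congrFun h 2

theorem mode_ne_zero (hb : b ≠ 0) (a p : ℤ) : mode a b p ≠ 0 := fun h => hb (congrFun h 1)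

theorem mode_ne_neg_mode (hb : b ≠ 0) (a p q : ℤ) : mode a b p ≠ -mode a b q := fun h => by
  have : b = -b := congrFun h 1
  omega

theorem axis_ne_zero : axis ≠ 0 := fun h => one_ne_zero (congrFun h 2)

theorem coeff_steady_mode (hb : b ≠ 0) (a p : ℤ) : coeff steady (mode a b p) = 0 := by
  have haxis : mode a b p ≠ axis := fun h => hb (congrFun h 1)
  have hneg : mode a b p ≠ -axis := fun h => hb (congrFun h 1)
  rw [steady, coeff_realMode, if_neg haxis, if_neg hneg, add_zero]

theorem coeff_perturbation_mode (hb : b ≠ 0) (a p : ℤ) :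
    coeff (perturbation a b) (mode a b p) = if p = 1 ∨ p = 2 then 1 else 0 := by
  simp only [perturbation, coeff_add, coeff_realMode, if_neg (mode_ne_neg_mode hb a p _),
    (mode_injective a b).eq_iff]
  split_ifs <;> first | omega | simp

theorem realMeanFree_perturbation (hb : b ≠ 0) (a : ℤ) : RealMeanFree (perturbation a b) :=
  (realMeanFree_realMode 1 (mode_ne_zero hb a 1)).add
    (realMeanFree_realMode 1 (mode_ne_zero hb a 2))

theorem multiplierNorm_perturbation_lt_top (m : Freq → ℂ) (a b : ℤ) :
    multiplierNorm m (perturbation a b) < ∞ :=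
  (multiplierNorm_add_le m _ _).trans_lt <| ENNReal.add_lt_top.2
    ⟨multiplierNorm_realMode_lt_top m _ _, multiplierNorm_realMode_lt_top m _ _⟩

end Chains

section Instability

variable {T : Freq → Fin 3 → ℝ} {normX : L2 → ℝ≥0∞} {t₁ : ℝ} {θ : ℝ → L2} {w v : Freq → ℂ}
  {A δ ε μ Λ : ℝ} {a b : ℤ}

theorem coeff_advection_steady_add (hw : ∀ k, kNorm k ≤ ‖w k‖) (hT : ∀ k j, |T k j| ≤ A * ‖w k‖)
    (haxis : T axis = 0) (haxis' : T (-axis) = 0) {f : L2} (hf : multiplierNorm w f < ∞)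
    (k : Freq) :
    coeff (advection T (steady + f)) k = coeff (advection T f) k -
      (T (k - axis) 2 * coeff f (k - axis) + T (k + axis) 2 * coeff f (k + axis)) := by
  rw [steady, coeff_advection_realMode_add haxis haxis' Complex.I
    (fun j => (multiplierNorm_velocity_symbol_le hT f j).trans_lt
      (ENNReal.mul_lt_top ENNReal.ofReal_lt_top hf))
    (fun j => (multiplierNorm_derivative_symbol_le hw f j).trans_lt hf),
    Fin.sum_univ_three, show axis 0 = 0 from rfl, show axis 1 = 0 from rfl,
    show axis 2 = 1 from rfl, Complex.conj_I, Int.cast_zero, Int.cast_one]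
  linear_combination (T (k - axis) 2 * coeff f (k - axis) +
    T (k + axis) 2 * coeff f (k + axis)) * Complex.I_mul_I

theorem norm_coeff_le_of_multiplierNorm_le (hδ : 0 ≤ δ) {f : L2}
    (hf : multiplierNorm w f ≤ ENNReal.ofReal δ) {k : Freq} (hwk : 1 ≤ ‖w k‖) :
    ‖coeff f k‖ ≤ δ := by
  have hle := (enorm_mul_coeff_le w f k).trans hf
  rw [← ofReal_norm, ENNReal.ofReal_le_ofReal_iff hδ, norm_mul] at hle
  exact (le_mul_of_one_le_left (norm_nonneg _) hwk).trans hle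

theorem re_coeff_advection_steady_add_le (hw : ∀ k, kNorm k ≤ ‖w k‖)
    (hT : ∀ k j, |T k j| ≤ A * ‖w k‖) (hA : 0 ≤ A) (haxis : T axis = 0) (haxis' : T (-axis) = 0)
    (hδ : 0 ≤ δ) {f : L2} (hf : multiplierNorm w f ≤ ENNReal.ofReal δ) (a b p : ℤ) :
    (coeff (advection T (steady + f)) (mode a b p)).re ≤
      3 * A * δ ^ 2 - ∑ q ∈ {p - 1, p + 1}, T (mode a b q) 2 * (coeff f (mode a b q)).re := by
  have hquadratic := (Complex.re_le_norm _).trans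
    (norm_coeff_advection_le hw hT hA hδ hf (mode a b p))
  rw [coeff_advection_steady_add hw hT haxis haxis' (hf.trans_lt ENNReal.ofReal_lt_top),
    mode_sub_axis, mode_add_axis, Complex.sub_re, Complex.add_re, Complex.re_ofReal_mul,
    Complex.re_ofReal_mul, Finset.sum_pair (by omega)]
  linarith

theorem IsSolution.integral_coupling_le (hw : ∀ k, kNorm k ≤ ‖w k‖)
    (hT : ∀ k j, |T k j| ≤ A * ‖w k‖) (hA : 0 ≤ A) (haxis : T axis = 0) (haxis' : T (-axis) = 0)
    (hb : b ≠ 0) (hδ : 0 ≤ δ)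
    (hθ : IsSolution T normX t₁ (steady + (ε : ℂ) • perturbation a b) θ)
    (hclose : ∀ t ∈ Icc 0 t₁, multiplierNorm w (θ t - steady) ≤ ENNReal.ofReal δ)
    (p : ℤ) {t : ℝ} (ht : t ∈ Icc 0 t₁) :
    (if p = 1 ∨ p = 2 then ε else 0) + ∫ s in (0 : ℝ)..t,
      (∑ q ∈ {p - 1, p + 1}, T (mode a b q) 2 * (coeff (θ s) (mode a b q)).re - 3 * A * δ ^ 2) ≤
      (coeff (θ t) (mode a b p)).re := by
  have hint := (hθ.mono ht.1 ht.2).integrable (mode a b p)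
  have hre : (∫ s in (0 : ℝ)..t, (coeff (advection T (θ s)) (mode a b p)).re) =
      (∫ s in (0 : ℝ)..t, coeff (advection T (θ s)) (mode a b p)).re :=
    Complex.reCLM.intervalIntegral_comp_comm hint
  have hinit : (coeff (steady + (ε : ℂ) • perturbation a b : L2) (mode a b p)).re =
      if p = 1 ∨ p = 2 then ε else 0 := by
    rw [coeff_add, coeff_steady_mode hb, coeff_smul, coeff_perturbation_mode hb]
    split_ifs <;> simp
  have hcoupling : ∫ s in (0 : ℝ)..t, (∑ q ∈ {p - 1, p + 1},
      T (mode a b q) 2 * (coeff (θ s) (mode a b q)).re - 3 * A * δ ^ 2) ≤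
      ∫ s in (0 : ℝ)..t, -(coeff (advection T (θ s)) (mode a b p)).re := by
    refine intervalIntegral.integral_mono_on ht.1 (ContinuousOn.intervalIntegrable_of_Icc ht.1 ?_)
      ⟨(Complex.reCLM.integrable_comp hint.1).neg, (Complex.reCLM.integrable_comp hint.2).neg⟩
      fun s hs => ?_
    · refine (continuousOn_finsetSum _ fun q _ => continuousOn_const.mul ?_).sub
        continuousOn_const
      exact Complex.continuous_re.comp_continuousOn
        ((hθ.mono ht.1 ht.2).continuousOn_coeff _)
    · have hpointwise := re_coeff_advection_steady_add_le hw hT hA haxis haxis' hδ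
        (hclose s (Icc_subset_Icc_right ht.2 hs)) a b p
      simp only [add_sub_cancel, coeff_sub, coeff_steady_mode hb, sub_zero] at hpointwise
      linarith
  rw [hθ.equation t ht, Complex.sub_re, hinit, ← hre]
  rw [intervalIntegral.integral_neg] at hcoupling
  linarith

theorem mul_two_site_le_sum_neighbors {g : ℤ → ℝ} (hg : ∀ p, 0 ≤ g p) (hμ₁ : μ ≤ g 1)
    (hμ₂ : μ ≤ g 2) (hε : 0 ≤ ε) (p : ℤ) :
    μ * (if p = 1 ∨ p = 2 then ε else 0) ≤
      ∑ q ∈ {p - 1, p + 1}, g q * if q = 1 ∨ q = 2 then ε else 0 := by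
  have hterm (q : ℤ) : 0 ≤ g q * if q = 1 ∨ q = 2 then ε else 0 :=
    mul_nonneg (hg q) (by split_ifs <;> simp [hε])
  rw [Finset.sum_pair (by omega)]
  obtain rfl | hp₁ := eq_or_ne p 1
  · refine le_add_of_nonneg_of_le (hterm _) ?_
    simpa using mul_le_mul_of_nonneg_right hμ₂ hε
  obtain rfl | hp₂ := eq_or_ne p 2
  · refine le_add_of_le_of_nonneg ?_ (hterm _)
    simpa using mul_le_mul_of_nonneg_right hμ₁ hε
  · simpa [hp₁, hp₂] using add_nonneg (hterm (p - 1)) (hterm (p + 1))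

theorem IsSolution.growth_near_steady (hw : ∀ k, kNorm k ≤ ‖w k‖)
    (hT : ∀ k j, |T k j| ≤ A * ‖w k‖) (hA : 0 ≤ A) (haxis : T axis = 0) (haxis' : T (-axis) = 0)
    (hb : b ≠ 0) (hpos : ∀ p, 0 ≤ T (mode a b p) 2) (hΛ : ∀ p, T (mode a b p) 2 ≤ Λ)
    (hμ₁ : μ ≤ T (mode a b 1) 2) (hμ₂ : μ ≤ T (mode a b 2) 2) (hδ : 0 ≤ δ) (hε : 0 ≤ ε)
    (ht₁ : 0 ≤ t₁) (hθ : IsSolution T normX t₁ (steady + (ε : ℂ) • perturbation a b) θ)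
    (hclose : ∀ t ∈ Icc 0 t₁, multiplierNorm w (θ t - steady) ≤ ENNReal.ofReal δ) :
    ε * Real.exp (μ * t₁) - 2 * (3 * A * δ ^ 2) * t₁ * Real.exp (2 * (2 * Λ) * t₁) ≤ δ := by
  have hbound (p : ℤ) : ∀ t ∈ Icc 0 t₁, |(coeff (θ t) (mode a b p)).re| ≤ δ := by
    intro t ht
    have hnorm := norm_coeff_le_of_multiplierNorm_le hδ (hclose t ht)
      ((one_le_kNorm (mode_ne_zero hb a p)).trans (hw _))
    rw [coeff_sub, coeff_steady_mode hb, sub_zero] at hnorm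
    exact (Complex.abs_re_le_norm _).trans hnorm
  have hgrowth := cooperative_growth (N := fun p : ℤ => {p - 1, p + 1})
    (c := fun _ q => T (mode a b q) 2) (Λ := 2 * Λ) (b := fun p => if p = 1 ∨ p = 2 then ε else 0)
    (x := fun p t => (coeff (θ t) (mode a b p)).re) (fun _ => hpos)
    (fun p => by rw [Finset.sum_pair (by omega)]; linarith [hΛ (p - 1), hΛ (p + 1)])
    (by positivity) (mul_two_site_le_sum_neighbors hpos hμ₁ hμ₂ hε)
    (fun p => Complex.continuous_re.comp_continuousOn (hθ.continuousOn_coeff _))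
    (fun p t ht => hθ.integral_coupling_le hw hT hA haxis haxis' hb hδ hclose p ht) hbound 1
    (right_mem_Icc.2 ht₁)
  simp only [true_or, if_true] at hgrowth
  exact hgrowth.trans (le_of_abs_le (hbound 1 t₁ (right_mem_Icc.2 ht₁)))

/-- The perturbation is multiplied by `ε → 0`: this removes the quadratic term of the equation from
the growth estimate while the linear growth factor survives. -/
theorem LipschitzWellPosed.exists_exp_growth_le
    (hwp : LipschitzWellPosed T (multiplierNorm w) (multiplierNorm v))
    (hw : ∀ k, kNorm k ≤ ‖w k‖) (hT : ∀ k j, |T k j| ≤ A * ‖w k‖) (hA : 0 ≤ A)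
    (haxis : T axis = 0) (haxis' : T (-axis) = 0) :
    ∃ t₁ > 0, ∃ K > 0, ∀ (a b : ℤ) (μ Λ : ℝ), b ≠ 0 → (∀ p, 0 ≤ T (mode a b p) 2) →
      (∀ p, T (mode a b p) 2 ≤ Λ) → μ ≤ T (mode a b 1) 2 → μ ≤ T (mode a b 2) 2 →
      Real.exp (μ * t₁) ≤ K * (multiplierNorm v (perturbation a b)).toReal := by
  obtain ⟨t₁, ht₁, K, hK, hsolve⟩ := hwp.exists_solution_near_stationary
    (realMeanFree_realMode Complex.I axis_ne_zero) (multiplierNorm_realMode_lt_top w _ _)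
    (multiplierNorm_realMode_lt_top v _ _) (coeff_advection_realMode haxis haxis' Complex.I)
  refine ⟨t₁, ht₁, K, hK, fun a b μ Λ hb hpos hΛ hμ₁ hμ₂ => ?_⟩
  have hG := multiplierNorm_perturbation_lt_top v a b
  set G := (multiplierNorm v (perturbation a b)).toReal
  have hgrowth : ∀ᶠ ε : ℝ in 𝓝[>] 0, Real.exp (μ * t₁) -
      ε * (2 * (3 * A * (K * G) ^ 2) * t₁ * Real.exp (2 * (2 * Λ) * t₁)) ≤ K * G := by
    filter_upwards [hsolve _ (realMeanFree_perturbation hb a) hG, self_mem_nhdsWithin]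
      with ε ⟨θ, hθ, hbound⟩ (hε : 0 < ε)
    have hclose : ∀ t ∈ Icc 0 t₁,
        multiplierNorm w (θ t - steady) ≤ ENNReal.ofReal (K * ε * G) := fun t ht => by
      rw [ENNReal.ofReal_mul (by positivity), ENNReal.ofReal_toReal hG.ne]
      exact hbound t ht
    have := hθ.growth_near_steady hw hT hA haxis haxis' hb hpos hΛ hμ₁ hμ₂ (by positivity) hε.le
      ht₁.le hclose
    exact le_of_mul_le_mul_left (by linarith) hε
  have hlimit : Tendsto (fun ε : ℝ => Real.exp (μ * t₁) -
      ε * (2 * (3 * A * (K * G) ^ 2) * t₁ * Real.exp (2 * (2 * Λ) * t₁))) (𝓝[>] 0)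
      (𝓝 (Real.exp (μ * t₁))) := by
    refine tendsto_nhdsWithin_of_tendsto_nhds ?_
    exact (by fun_prop : Continuous _).tendsto' _ _ (by simp)
  exact le_of_tendsto hlimit hgrowth

end Instability

section Symbol

variable {Ω β η α : ℝ}

theorem mgSymbol_of_eq_zero (Ω β η : ℝ) {k : Freq} (hk : k 2 = 0) : mgSymbol Ω β η k = 0 :=
  if_pos hk

theorem mgSymbol_of_ne_zero (Ω β η : ℝ) {k : Freq} (hk : k 2 ≠ 0) :
    mgSymbol Ω β η k =
      (4 * Ω ^ 2 * (k 2 : ℝ) ^ 2 * normSq k + (β ^ 2 / η) ^ 2 * (k 1 : ℝ) ^ 4)⁻¹ •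
      ![2 * Ω * k 1 * k 2 * normSq k - (β ^ 2 / η) * k 0 * (k 1 : ℝ) ^ 2 * k 2,
        -2 * Ω * k 0 * k 2 * normSq k - (β ^ 2 / η) * (k 1 : ℝ) ^ 3 * k 2,
        (β ^ 2 / η) * (k 1 : ℝ) ^ 2 * ((k 0 : ℝ) ^ 2 + (k 1 : ℝ) ^ 2)] := by
  rw [mgSymbol, if_neg hk]
  ext j
  fin_cases j <;> simp [div_eq_inv_mul]

theorem mgSymbol_axis (Ω β η : ℝ) : mgSymbol Ω β η axis = 0 := by
  rw [mgSymbol_of_ne_zero Ω β η (by decide)]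
  simp [axis]

theorem mgSymbol_neg_axis (Ω β η : ℝ) : mgSymbol Ω β η (-axis) = 0 := by
  rw [mgSymbol_of_ne_zero Ω β η (by decide)]
  simp [axis]

theorem generalizedMGSymbol_zero (Ω β η : ℝ) : generalizedMGSymbol Ω β η 0 = mgSymbol Ω β η := by
  ext k j
  simp [generalizedMGSymbol]

theorem generalizedMGSymbol_of_eq_zero (Ω β η α : ℝ) {k : Freq} (hk : mgSymbol Ω β η k = 0) :
    generalizedMGSymbol Ω β η α k = 0 := by
  rw [generalizedMGSymbol, hk, smul_zero]

theorem abs_coriolis_numerator_le (hΩ : 0 ≤ Ω) {k : Freq} (hk : k 2 ≠ 0) (i : Fin 3) :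
    |2 * Ω * k i * k 2 * normSq k| ≤ kNorm k * (2 * Ω * |(k 2 : ℝ)| ^ 2 * kNorm k ^ 2) := by
  have hk₃ : 1 ≤ |(k 2 : ℝ)| := by exact_mod_cast Int.one_le_abs hk
  have hM : 0 ≤ kNorm k := kNorm_nonneg k
  rw [← sq_kNorm, abs_mul, abs_mul, abs_mul, abs_of_nonneg (by positivity : 0 ≤ 2 * Ω),
    abs_of_nonneg (sq_nonneg (kNorm k))]
  calc 2 * Ω * |(k i : ℝ)| * |(k 2 : ℝ)| * kNorm k ^ 2
      ≤ 2 * Ω * kNorm k * |(k 2 : ℝ)| ^ 2 * kNorm k ^ 2 := by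
        gcongr
        exacts [abs_apply_le_kNorm k i, le_self_pow₀ hk₃ two_ne_zero]
    _ = _ := by ring

theorem abs_magnetic_numerator_le (κ : ℝ) {k : Freq} (hk : k ≠ 0) (i : Fin 3) :
    |κ * (k 1 : ℝ) ^ 2 * k 2 * k i| ≤
      kNorm k * (|κ| * (k 1 : ℝ) ^ 2 * |(k 2 : ℝ)| * kNorm k) := by
  have hM : 0 ≤ kNorm k := kNorm_nonneg k
  rw [abs_mul, abs_mul, abs_mul, abs_sq]
  calc |κ| * (k 1 : ℝ) ^ 2 * |(k 2 : ℝ)| * |(k i : ℝ)|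
      ≤ |κ| * (k 1 : ℝ) ^ 2 * |(k 2 : ℝ)| * (kNorm k * kNorm k) := by
        gcongr
        exact (abs_apply_le_kNorm k i).trans (le_mul_of_one_le_left hM (one_le_kNorm hk))
    _ = _ := by ring

theorem abs_magnetic_vertical_numerator_le (κ : ℝ) {k : Freq} (hk : k 2 ≠ 0) :
    |κ * (k 1 : ℝ) ^ 2 * ((k 0 : ℝ) ^ 2 + (k 1 : ℝ) ^ 2)| ≤
      kNorm k * (|κ| * (k 1 : ℝ) ^ 2 * |(k 2 : ℝ)| * kNorm k) := by
  have hk₃ : 1 ≤ |(k 2 : ℝ)| := by exact_mod_cast Int.one_le_abs hk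
  have hN : (k 0 : ℝ) ^ 2 + (k 1 : ℝ) ^ 2 ≤ kNorm k ^ 2 := by
    rw [sq_kNorm, normSq_eq]
    exact le_add_of_nonneg_right (sq_nonneg _)
  rw [abs_mul, abs_mul, abs_sq, abs_of_nonneg (by positivity : 0 ≤ (k 0 : ℝ) ^ 2 + (k 1 : ℝ) ^ 2)]
  calc |κ| * (k 1 : ℝ) ^ 2 * ((k 0 : ℝ) ^ 2 + (k 1 : ℝ) ^ 2)
      ≤ |κ| * (k 1 : ℝ) ^ 2 * (|(k 2 : ℝ)| * kNorm k ^ 2) := by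
        gcongr
        exact hN.trans (le_mul_of_one_le_left (sq_nonneg _) hk₃)
    _ = _ := by ring

theorem abs_mgSymbol_numerator_le (hΩ : 0 ≤ Ω) (κ : ℝ) {k : Freq} (hk : k 2 ≠ 0) (j : Fin 3) :
    |![2 * Ω * k 1 * k 2 * normSq k - κ * k 0 * (k 1 : ℝ) ^ 2 * k 2,
        -2 * Ω * k 0 * k 2 * normSq k - κ * (k 1 : ℝ) ^ 3 * k 2,
        κ * (k 1 : ℝ) ^ 2 * ((k 0 : ℝ) ^ 2 + (k 1 : ℝ) ^ 2)] j| ≤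
      kNorm k * (2 * Ω * |(k 2 : ℝ)| ^ 2 * kNorm k ^ 2 +
        |κ| * (k 1 : ℝ) ^ 2 * |(k 2 : ℝ)| * kNorm k) := by
  have hM : 0 ≤ kNorm k := kNorm_nonneg k
  have hk₀ : k ≠ 0 := fun h => hk (congrFun h 2)
  rw [mul_add (kNorm k)]
  fin_cases j
  · calc |2 * Ω * k 1 * k 2 * normSq k - κ * k 0 * (k 1 : ℝ) ^ 2 * k 2|
        = |2 * Ω * k 1 * k 2 * normSq k - κ * (k 1 : ℝ) ^ 2 * k 2 * k 0| := by ring_nf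
      _ ≤ _ := abs_sub _ _
      _ ≤ _ := add_le_add (abs_coriolis_numerator_le hΩ hk 1) (abs_magnetic_numerator_le κ hk₀ 0)
  · calc |-2 * Ω * k 0 * k 2 * normSq k - κ * (k 1 : ℝ) ^ 3 * k 2|
        = |2 * Ω * k 0 * k 2 * normSq k + κ * (k 1 : ℝ) ^ 2 * k 2 * k 1| := by
          rw [← abs_neg]
          ring_nf
      _ ≤ _ := abs_add_le _ _
      _ ≤ _ := add_le_add (abs_coriolis_numerator_le hΩ hk 0) (abs_magnetic_numerator_le κ hk₀ 1)
  · exact (abs_magnetic_vertical_numerator_le κ hk).trans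
      (le_add_of_nonneg_left (by positivity))

theorem abs_mgSymbol_le (hΩ : 0 < Ω) (β η : ℝ) (k : Freq) (j : Fin 3) :
    |mgSymbol Ω β η k j| ≤ kNorm k / Ω := by
  have hM : 0 ≤ kNorm k := kNorm_nonneg k
  by_cases hk : k 2 = 0
  · rw [mgSymbol_of_eq_zero Ω β η hk, Pi.zero_apply, abs_zero]
    positivity
  set κ := β ^ 2 / η
  have hk₃ : 1 ≤ |(k 2 : ℝ)| := by exact_mod_cast Int.one_le_abs hk
  have hMpos : 0 < kNorm k := zero_lt_one.trans_le (hk₃.trans (abs_apply_le_kNorm k 2))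
  set X := 2 * Ω * |(k 2 : ℝ)| * kNorm k
  set Y := |κ| * (k 1 : ℝ) ^ 2
  have hD : 4 * Ω ^ 2 * (k 2 : ℝ) ^ 2 * normSq k + κ ^ 2 * (k 1 : ℝ) ^ 4 = X ^ 2 + Y ^ 2 := by
    rw [← sq_kNorm, ← sq_abs (k 2 : ℝ), ← sq_abs κ]
    ring
  have hDpos : 0 < X ^ 2 + Y ^ 2 := by positivity
  rw [mgSymbol_of_ne_zero Ω β η hk, Pi.smul_apply, smul_eq_mul, abs_mul, abs_inv, hD,
    abs_of_pos hDpos, inv_mul_le_iff₀ hDpos]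
  calc _ ≤ kNorm k * (2 * Ω * |(k 2 : ℝ)| ^ 2 * kNorm k ^ 2 +
        |κ| * (k 1 : ℝ) ^ 2 * |(k 2 : ℝ)| * kNorm k) := abs_mgSymbol_numerator_le hΩ.le κ hk j
    _ = kNorm k / (2 * Ω) * (X ^ 2 + X * Y) := by
        simp only [X, Y]
        field_simp
    _ ≤ kNorm k / (2 * Ω) * (2 * (X ^ 2 + Y ^ 2)) := by
        gcongr
        nlinarith [sq_nonneg (X - Y), sq_nonneg Y]
    _ = (X ^ 2 + Y ^ 2) * (kNorm k / Ω) := by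
        field_simp

theorem abs_generalizedMGSymbol_le (hΩ : 0 < Ω) (β η : ℝ) {q : ℝ} (hα : 0 ≤ α + 1)
    (hq : α + 1 ≤ q) (k : Freq) (j : Fin 3) :
    |generalizedMGSymbol Ω β η α k j| ≤ 1 / Ω * ‖sobolevWeight q k‖ := by
  obtain rfl | hk := eq_or_ne k 0
  · rw [generalizedMGSymbol_of_eq_zero Ω β η α (mgSymbol_of_eq_zero Ω β η rfl), Pi.zero_apply,
      abs_zero]
    positivity
  have hM : 0 < kNorm k := zero_lt_one.trans_le (one_le_kNorm hk)
  rw [generalizedMGSymbol, Pi.smul_apply, smul_eq_mul, abs_mul, abs_of_pos (by positivity)]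
  calc kNorm k ^ α * |mgSymbol Ω β η k j| ≤ kNorm k ^ α * (kNorm k / Ω) := by
        gcongr
        exact abs_mgSymbol_le hΩ β η k j
    _ = 1 / Ω * kNorm k ^ (α + 1) := by
        rw [Real.rpow_add_one hM.ne']
        ring
    _ ≤ 1 / Ω * ‖sobolevWeight q k‖ := by
        gcongr
        exact kNorm_rpow_le_norm_sobolevWeight hα hq k

theorem generalizedMGSymbol_two_nonneg (Ω β : ℝ) (hη : 0 ≤ η) (α : ℝ) (k : Freq) :
    0 ≤ generalizedMGSymbol Ω β η α k 2 := by
  have hM := kNorm_nonneg k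
  have hN := normSq_nonneg k
  by_cases hk : k 2 = 0
  · rw [generalizedMGSymbol_of_eq_zero Ω β η α (mgSymbol_of_eq_zero Ω β η hk), Pi.zero_apply]
  · rw [generalizedMGSymbol, mgSymbol_of_ne_zero Ω β η hk]
    simp only [Pi.smul_apply, smul_eq_mul, Matrix.cons_val]
    positivity

theorem normSq_mode (a b p : ℤ) : normSq (mode a b p) = (a : ℝ) ^ 2 + (b : ℝ) ^ 2 + (p : ℝ) ^ 2 :=
  normSq_eq _

theorem generalizedMGSymbol_mode_two {a b p : ℤ} (hp : p ≠ 0) :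
    generalizedMGSymbol Ω β η α (mode a b p) 2 = kNorm (mode a b p) ^ α *
      ((β ^ 2 / η * (b : ℝ) ^ 2 * ((a : ℝ) ^ 2 + (b : ℝ) ^ 2)) /
        (4 * Ω ^ 2 * (p : ℝ) ^ 2 * normSq (mode a b p) + (β ^ 2 / η) ^ 2 * (b : ℝ) ^ 4)) := by
  rw [generalizedMGSymbol, mgSymbol_of_ne_zero Ω β η (k := mode a b p) hp, div_eq_inv_mul (_ * _)]
  rfl

theorem generalizedMGSymbol_mode_two_le (hΩ : Ω ≠ 0) (β : ℝ) (hη : 0 ≤ η) (hα : α ≤ 4)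
    (a b p : ℤ) :
    generalizedMGSymbol Ω β η α (mode a b p) 2 ≤
      β ^ 2 / η * (b : ℝ) ^ 2 * ((a : ℝ) ^ 2 + (b : ℝ) ^ 2) *
        ((a : ℝ) ^ 2 + (b : ℝ) ^ 2 + 1) / (4 * Ω ^ 2) := by
  obtain rfl | hp := eq_or_ne p 0
  · rw [generalizedMGSymbol_of_eq_zero Ω β η α (mgSymbol_of_eq_zero Ω β η rfl), Pi.zero_apply]
    positivity
  have hM : 1 ≤ kNorm (mode a b p) := one_le_kNorm fun h => hp (congrFun h 2)
  have hp₁ : 1 ≤ (p : ℝ) ^ 2 := by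
    exact_mod_cast (Int.one_le_abs (pow_ne_zero 2 hp)).trans_eq (abs_sq p)
  have hN : normSq (mode a b p) ≤ ((a : ℝ) ^ 2 + (b : ℝ) ^ 2 + 1) * (p : ℝ) ^ 2 := by
    rw [normSq_mode]
    nlinarith [sq_nonneg (a : ℝ), sq_nonneg (b : ℝ)]
  have hpow : kNorm (mode a b p) ^ α ≤ normSq (mode a b p) ^ 2 := by
    rw [← sq_kNorm, ← pow_mul, ← Real.rpow_natCast]
    exact Real.rpow_le_rpow_of_exponent_le hM (by norm_num; exact hα)
  have hNpos : 0 < normSq (mode a b p) := by rw [← sq_kNorm]; positivity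
  set N := normSq (mode a b p)
  set L := (a : ℝ) ^ 2 + (b : ℝ) ^ 2 + 1
  set F := β ^ 2 / η * (b : ℝ) ^ 2 * ((a : ℝ) ^ 2 + (b : ℝ) ^ 2)
  rw [generalizedMGSymbol_mode_two hp]
  calc kNorm (mode a b p) ^ α * (F / (4 * Ω ^ 2 * (p : ℝ) ^ 2 * N + (β ^ 2 / η) ^ 2 * (b : ℝ) ^ 4))
      ≤ N ^ 2 * (F / (4 * Ω ^ 2 * (p : ℝ) ^ 2 * N)) := by
        gcongr
        exact le_add_of_nonneg_right (by positivity)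
    _ = F * N / (4 * Ω ^ 2 * (p : ℝ) ^ 2) := by field_simp
    _ ≤ F * (L * (p : ℝ) ^ 2) / (4 * Ω ^ 2 * (p : ℝ) ^ 2) := by gcongr
    _ = F * L / (4 * Ω ^ 2) := by field_simp

theorem sq_le_kNorm_mode (n : ℕ) (p : ℤ) : (n : ℝ) ^ 2 ≤ kNorm (mode (n ^ 2) n p) := by
  have := (le_abs_self _).trans (abs_apply_le_kNorm (mode (n ^ 2) n p) 0)
  simpa [mode] using this

theorem normSq_mode_le {n : ℕ} (hn : 1 ≤ n) {p : ℤ} (hp : p ^ 2 ≤ 4) :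
    normSq (mode (n ^ 2) n p) ≤ 6 * (n : ℝ) ^ 4 := by
  have hn₁ : (1 : ℝ) ≤ n := by exact_mod_cast hn
  have hp₂ : (p : ℝ) ^ 2 ≤ 4 := by exact_mod_cast hp
  have h₂ : (n : ℝ) ^ 2 ≤ (n : ℝ) ^ 4 := pow_le_pow_right₀ hn₁ (by norm_num)
  have h₄ : 1 ≤ (n : ℝ) ^ 4 := one_le_pow₀ hn₁
  rw [normSq_mode]
  push_cast
  linarith

theorem kNorm_mode_le {n : ℕ} (hn : 1 ≤ n) {p : ℤ} (hp : p ^ 2 ≤ 4) :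
    kNorm (mode (n ^ 2) n p) ≤ 3 * (n : ℝ) ^ 2 := by
  refine Real.sqrt_le_iff.2 ⟨by positivity, (normSq_mode_le hn hp).trans ?_⟩
  nlinarith [sq_nonneg ((n : ℝ) ^ 2)]

theorem le_generalizedMGSymbol_mode_two (Ω : ℝ) (hβ : 0 < β) (hη : 0 < η) (hα : 0 ≤ α + 1)
    {n : ℕ} (hn : 1 ≤ n) {p : ℤ} (hp : p ≠ 0) (hp₂ : p ^ 2 ≤ 4) :
    (β ^ 2 / η) / (3 * (96 * Ω ^ 2 + (β ^ 2 / η) ^ 2)) * ((n : ℝ) ^ 2) ^ (α + 1) ≤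
      generalizedMGSymbol Ω β η α (mode (n ^ 2) n p) 2 := by
  have hp₃ : (p : ℝ) ^ 2 ≤ 4 := by exact_mod_cast hp₂
  have hlower := sq_le_kNorm_mode n p
  have hupper := kNorm_mode_le hn hp₂
  have hN := normSq_mode_le hn hp₂
  have hM : 0 < kNorm (mode (n ^ 2) n p) := lt_of_lt_of_le (by positivity) hlower
  have hNpos : 0 < normSq (mode (n ^ 2) n p) := by rw [← sq_kNorm]; positivity
  rw [generalizedMGSymbol_mode_two hp]
  set κ := β ^ 2 / η
  have hκ : 0 < κ := by positivity
  set M := kNorm (mode (n ^ 2) n p)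
  set N := normSq (mode (n ^ 2) n p)
  have : 0 < 4 * Ω ^ 2 * (p : ℝ) ^ 2 * N + κ ^ 2 * (n : ℝ) ^ 4 := by positivity
  have hD : 4 * Ω ^ 2 * (p : ℝ) ^ 2 * N + κ ^ 2 * (n : ℝ) ^ 4 ≤
      (96 * Ω ^ 2 + κ ^ 2) * (n : ℝ) ^ 4 := by
    calc _ ≤ 4 * Ω ^ 2 * 4 * (6 * (n : ℝ) ^ 4) + κ ^ 2 * (n : ℝ) ^ 4 := by gcongr
      _ = _ := by ring
  push_cast
  calc κ / (3 * (96 * Ω ^ 2 + κ ^ 2)) * ((n : ℝ) ^ 2) ^ (α + 1)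
      ≤ κ / (3 * (96 * Ω ^ 2 + κ ^ 2)) * M ^ (α + 1) := by gcongr
    _ = M ^ α * (κ / (3 * (96 * Ω ^ 2 + κ ^ 2)) * M) := by
        rw [Real.rpow_add_one hM.ne']
        ring
    _ ≤ M ^ α * (κ / (3 * (96 * Ω ^ 2 + κ ^ 2)) * (3 * (n : ℝ) ^ 2)) := by gcongr
    _ = M ^ α * (κ * (n : ℝ) ^ 2 * ((n : ℝ) ^ 2) ^ 2 /
          ((96 * Ω ^ 2 + κ ^ 2) * (n : ℝ) ^ 4)) := by
        field_simp
    _ ≤ _ := by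
        gcongr
        exact le_add_of_nonneg_right (sq_nonneg _)

end Symbol

section GevreySize

theorem norm_gevreyWeight_le (r : ℝ) {s : ℝ} (hs : 0 ≤ s) (τ : ℝ) {k : Freq} {R : ℝ}
    (hk : kNorm k ≤ R) :
    ‖gevreyWeight r s τ k‖ ≤ R ^ |r| * Real.exp (|τ| * R ^ (1 / s)) := by
  have hM := kNorm_nonneg k
  have hR := hM.trans hk
  obtain rfl | hk₀ := eq_or_ne k 0
  · rw [gevreyWeight, if_pos rfl, norm_zero]
    positivity
  rw [norm_gevreyWeight hk₀]
  calc kNorm k ^ r * Real.exp (τ * kNorm k ^ (1 / s))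
      ≤ kNorm k ^ |r| * Real.exp (|τ| * kNorm k ^ (1 / s)) := by
        gcongr
        exacts [one_le_kNorm hk₀, le_abs_self r, le_abs_self τ]
    _ ≤ R ^ |r| * Real.exp (|τ| * R ^ (1 / s)) := by gcongr

theorem multiplierNorm_gevreyWeight_realMode_one_le (r : ℝ) {s : ℝ} (hs : 0 ≤ s) (τ : ℝ)
    {k : Freq} {R : ℝ} (hk : kNorm k ≤ R) :
    multiplierNorm (gevreyWeight r s τ) (realMode 1 k) ≤
      ENNReal.ofReal (2 * (R ^ |r| * Real.exp (|τ| * R ^ (1 / s)))) := by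
  have hR := (kNorm_nonneg k).trans hk
  refine (multiplierNorm_realMode_le _ 1 k).trans ?_
  rw [enorm_one, one_mul, two_mul, ENNReal.ofReal_add (by positivity) (by positivity),
    ← ofReal_norm, ← ofReal_norm]
  gcongr
  exacts [norm_gevreyWeight_le r hs τ hk, norm_gevreyWeight_le r hs τ ((kNorm_neg k).trans_le hk)]

theorem toReal_multiplierNorm_gevreyWeight_perturbation_le (r : ℝ) {s : ℝ} (hs : 0 ≤ s) (τ : ℝ)
    {n : ℕ} (hn : 1 ≤ n) :
    (multiplierNorm (gevreyWeight r s τ) (perturbation (n ^ 2) n)).toReal ≤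
      4 * ((3 * (n : ℝ) ^ 2) ^ |r| * Real.exp (|τ| * (3 * (n : ℝ) ^ 2) ^ (1 / s))) := by
  refine ENNReal.toReal_le_of_le_ofReal (by positivity) ?_
  rw [perturbation, show (4 : ℝ) = 2 + 2 by norm_num, add_mul,
    ENNReal.ofReal_add (by positivity) (by positivity)]
  exact (multiplierNorm_add_le _ _ _).trans <| add_le_add
    (multiplierNorm_gevreyWeight_realMode_one_le r hs τ (kNorm_mode_le hn (by norm_num)))
    (multiplierNorm_gevreyWeight_realMode_one_le r hs τ (kNorm_mode_le hn (by norm_num)))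

end GevreySize

section Asymptotics

theorem isLittleO_rpow_rpow_atTop {a b : ℝ} (h : b < a) :
    (fun x : ℝ => x ^ b) =o[atTop] fun x : ℝ => x ^ a := by
  refine (Asymptotics.isLittleO_iff_tendsto' ?_).2 ?_
  · filter_upwards [eventually_gt_atTop 0] with x hx h₀
    exact absurd h₀ (Real.rpow_pos_of_pos hx a).ne'
  · refine (tendsto_rpow_neg_atTop (sub_pos.2 h)).congr' ?_
    filter_upwards [eventually_gt_atTop 0] with x hx
    rw [neg_sub, Real.rpow_sub hx]

theorem isLittleO_log_add_rpow_atTop {a b : ℝ} (ha : 0 < a) (hba : b < a) (A B C : ℝ) :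
    (fun x : ℝ => A + B * Real.log x + C * x ^ b) =o[atTop] fun x : ℝ => x ^ a :=
  ((Asymptotics.isLittleO_const_left.2
    (Or.inr (tendsto_norm_atTop_atTop.comp (tendsto_rpow_atTop ha)))).add
      ((isLittleO_log_rpow_atTop ha).const_mul_left B)).add
    ((isLittleO_rpow_rpow_atTop hba).const_mul_left C)

theorem eventually_lt_exp_rpow {a b c d K : ℝ} (ha : 0 < a) (hba : b < a) (hc : 0 < c)
    (hd : 0 < d) (hK : 0 < K) (r τ : ℝ) :
    ∀ᶠ x : ℝ in atTop, K * ((d * x) ^ r * Real.exp (τ * (d * x) ^ b)) < Real.exp (c * x ^ a) := by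
  have hexponent := isLittleO_log_add_rpow_atTop ha hba (Real.log K + r * Real.log d) r (τ * d ^ b)
  filter_upwards [hexponent.bound (half_pos hc), eventually_gt_atTop 0] with x hx hx₀
  have hxa : 0 < x ^ a := Real.rpow_pos_of_pos hx₀ a
  rw [Real.norm_of_nonneg hxa.le] at hx
  calc K * ((d * x) ^ r * Real.exp (τ * (d * x) ^ b))
      = Real.exp (Real.log K + r * Real.log d + r * Real.log x + τ * d ^ b * x ^ b) := by
        rw [Real.rpow_def_of_pos (by positivity), Real.log_mul hd.ne' hx₀.ne',
          Real.mul_rpow hd.le hx₀.le, ← Real.exp_add]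
        nth_rw 1 [← Real.exp_log hK]
        rw [← Real.exp_add]
        ring_nf
    _ < Real.exp (c * x ^ a) := by
        rw [Real.exp_lt_exp]
        linarith [(le_abs_self _).trans hx, mul_pos hc hxa]

end Asymptotics

theorem LipschitzWellPosed.exists_exp_le_gevrey {Ω β η α q s r τ : ℝ}
    (hwp : LipschitzWellPosed (generalizedMGSymbol Ω β η α) (sobolevNorm q) (gevreyNorm r s τ))
    (hΩ : 0 < Ω) (hβ : 0 < β) (hη : 0 < η) (hα : 0 ≤ α + 1) (hα₄ : α ≤ 4) (hq : 1 ≤ q)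
    (hαq : α + 1 ≤ q) (hs : 0 ≤ s) :
    ∃ c > 0, ∃ K > 0, ∀ n : ℕ, 1 ≤ n → Real.exp (c * ((n : ℝ) ^ 2) ^ (α + 1)) ≤
      K * ((3 * (n : ℝ) ^ 2) ^ |r| * Real.exp (|τ| * (3 * (n : ℝ) ^ 2) ^ (1 / s))) := by
  rw [sobolevNorm_eq_multiplierNorm, gevreyNorm_eq_multiplierNorm] at hwp
  have hweight (k : Freq) : kNorm k ≤ ‖sobolevWeight q k‖ := by
    simpa using kNorm_rpow_le_norm_sobolevWeight zero_le_one hq k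
  obtain ⟨t₁, ht₁, K, hK, hgrowth⟩ := hwp.exists_exp_growth_le hweight
    (abs_generalizedMGSymbol_le hΩ β η hα hαq) (by positivity)
    (generalizedMGSymbol_of_eq_zero Ω β η α (mgSymbol_axis Ω β η))
    (generalizedMGSymbol_of_eq_zero Ω β η α (mgSymbol_neg_axis Ω β η))
  refine ⟨(β ^ 2 / η) / (3 * (96 * Ω ^ 2 + (β ^ 2 / η) ^ 2)) * t₁, by positivity, K * 4,
    by positivity, fun n hn => ?_⟩
  rw [mul_right_comm, mul_assoc K]
  exact (hgrowth (n ^ 2) n _ _ (by positivity)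
    (fun _ => generalizedMGSymbol_two_nonneg Ω β hη.le α _)
    (generalizedMGSymbol_mode_two_le hΩ.ne' β hη.le hα₄ _ _)
    (le_generalizedMGSymbol_mode_two Ω hβ hη hα hn one_ne_zero (by norm_num))
    (le_generalizedMGSymbol_mode_two Ω hβ hη hα hn two_ne_zero (by norm_num))).trans <|
      mul_le_mul_of_nonneg_left
        (toReal_multiplierNorm_gevreyWeight_perturbation_le r hs τ hn) hK.le

end ActiveScalar

end

open ActiveScalar Filter in
theorem mainTheorem4_general {Ω β η : ℝ} (hΩ : 0 < Ω) (hβ : 0 < β) (hη : 0 < η) (r τ : ℝ)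
    {α q s : ℝ} (hα : -1 < α) (hα₄ : α ≤ 4) (hq : 1 ≤ q) (hαq : α + 1 ≤ q)
    (hs : 1 / (α + 1) < s) :
    LipschitzIllPosed (generalizedMGSymbol Ω β η α) (sobolevNorm q) (gevreyNorm r s τ) := by
  intro hwp
  have hα₁ : 0 < α + 1 := by linarith
  have hs₀ : 0 < s := (one_div_pos.2 hα₁).trans hs
  obtain ⟨c, hc, K, hK, hle⟩ :=
    hwp.exists_exp_le_gevrey hΩ hβ hη hα₁.le hα₄ hq hαq hs₀.le
  have hlim : Tendsto (fun n : ℕ => (n : ℝ) ^ 2) atTop atTop :=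
    (tendsto_pow_atTop two_ne_zero).comp tendsto_natCast_atTop_atTop
  obtain ⟨n, hlt, hn⟩ := ((hlim.eventually (eventually_lt_exp_rpow hα₁
    ((one_div_lt hs₀ hα₁).2 hs) hc zero_lt_three hK |r| |τ|)).and (eventually_ge_atTop 1)).exists
  exact (hle n hn).not_gt hlt

theorem mainTheorem4 (Ω β η : ℝ) (hΩ : 0 < Ω) (hβ : 0 < β) (hη : 0 < η)
    (r : ℝ) (hr : 3 < r) :
    (∀ α q s τ : ℝ, 0 ≤ α → α ≤ 1 → α + 7 / 4 < q → 1 / (α + 1) < s → 0 < τ →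
      ActiveScalar.LipschitzIllPosed (ActiveScalar.generalizedMGSymbol Ω β η α)
        (ActiveScalar.sobolevNorm q) (ActiveScalar.gevreyNorm r s τ)) ∧
    (∀ q s τ : ℝ, 7 / 4 < q → 1 < s → 0 < τ →
      ActiveScalar.LipschitzIllPosed (ActiveScalar.mgSymbol Ω β η)
        (ActiveScalar.sobolevNorm q) (ActiveScalar.gevreyNorm r s τ)) := by
  refine ⟨fun α q s τ hα hα₁ hq hs _ => mainTheorem4_general hΩ hβ hη r τ (by linarith)
    (by linarith) (by linarith) (by linarith) hs, fun q s τ hq hs _ => ?_⟩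
  rw [← ActiveScalar.generalizedMGSymbol_zero]
  exact mainTheorem4_general hΩ hβ hη r τ (by norm_num) (by norm_num) (by linarith) (by linarith)
    (by simpa using hs)
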